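/- Let $\lambda_{ss},\lambda_{cs0},\lambda_{cs1},\lambda_u$ be real numbers with $0<\lambda_{ss}<\lambda_{cs0}<\tfrac12<\lambda_{cs1}<1<\lambda_{cs0}+\lambda_{cs1}$, $\lambda_u>2$ and $\lambda_{cs0}\lambda_{cs1}\lambda_u^2<1$. Let $a_1,a_2,a_3,a_4,\delta$ be real numbers with $a_1>(1-2\lambda_u^{-1})^{-1}$, $a_2,a_4>0$, $0<|a_3|<1-2\lambda_{ss}$ and $0<\delta<\tfrac12-\lambda_u^{-1}$. Put $\mathbb B=[0,1]^3$, $\mathbb V_0=[0,\lambda_u^{-1}]\times[0,1]^2$, $\mathbb V_1=[1-\lambda_u^{-1},1]\times[0,1]^2$ and $\mathbb G=\mathbb B\setminus(\mathbb V_0\cup\mathbb V_1)$. Let $1\le r<\infty$ be an integer and let $f:\mathbb R^3\to\mathbb R^3$ be a $C^r$ diffeomorphism such that * $f(x,y,z)=(\lambda_u x,\ \lambda_{ss}y,\ \lambda_{cs0}z)$ on $\mathbb V_0$, and $f(x,y,z)=(\lambda_u(1-x),\ 1-\lambda_{ss}y,\ \lambda_{cs1}z+1-\lambda_{cs1})$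 on $\mathbb V_1$ (an affine cs-blender horseshoe); * $f(\mathbb G)\subset\mathbb R^3\setminus\mathbb B$; * $f^2(x,y,z)=\bigl(-a_1(x-\tfrac12)^2+a_2z,\ a_3(y-\tfrac12)+\tfrac12,\ a_4(x-\tfrac12)+\tfrac12\bigr)$ for all $(x,y,z)\in\mathbb G$ with $|x-\tfrac12|<\delta$ (a quadratic tangency). Then every neighbourhood of $f$ in the set of $C^r$ diffeomorphisms of $\mathbb R^3$, even in the strong (Whitney) $C^r$ topology, contains a diffeomorphism with a historic contracting wandering domain, and it contains another (different) diffeomorphism $g$ with a non-trivial Dirac physical measure that is supported on a saddle periodic orbit and associated with a contracting wandering domain of $g$. Here a *wandering domain* of $g$ is a non-empty connected open set $D$ such that $g^i(D)\cap g^j(D)=\emptyset$ for all integers $i\ne j$, $i,j\ge 0$, and such that the union of the $\omega$-limit sets of the points of $D$ is not equal to a single periodic orbit. It is *contracting* if $\operatorname{diam} g^i(D)\to0$ as $i\to\infty$. It is *historic* if for every $x\in D$ the measures $\frac1{n+1}\sum_{i=0}^n\delta_{g^i(x)}$ do not converge, as $n\to\infty$, to any finite measure in the weak* topology (tested against compactly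 supported continuous functions). A *non-trivial Dirac physical measure associated with* $D$ is a probability measure $\nu$ whose support is equal to a periodic orbit of $g$ of saddle type (the derivative of the return map has complex eigenvalues inside and outside the unit circle and none on it), such that $\frac1{n+1}\sum_{i=0}^n\delta_{g^i(x)}\to\nu$ in the weak* topology for every $x\in D$. -/

import Mathlib

open Set Filter Topology MeasureTheory

noncomputable section

namespace WildBlender

/-- Three-dimensional space with coordinates `(x, y, z)`. None of the notions below changes if
the norm is replaced by an equivalent one. -/
abbrev E3 : Type := ℝ × ℝ × ℝ

/-- `Diff r` is the set of `C^r` diffeomorphisms of three-dimensional space. -/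
abbrev Diff (r : ℕ) : Type :=
  Diffeomorph (modelWithCornersSelf ℝ E3) (modelWithCornersSelf ℝ E3) E3 E3 (r : WithTop ℕ∞)

/-! ### The `C^r` topology -/

/-- The basic strong (Whitney) `C^r` neighbourhood of `f` given by a function `ε`: all `g` whose
derivatives of every order `i ≤ r` are at distance less than `ε p` from those of `f` at every
point `p`. -/
def crBall {r : ℕ} (f : Diff r) (ε : E3 → ℝ) : Set (Diff r) :=
  {g | ∀ i : ℕ, i ≤ r → ∀ p : E3,
    ‖iteratedFDeriv ℝ i (fun q : E3 => g q) p - iteratedFDeriv ℝ i (fun q : E3 => f q) p‖ < ε p}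

/-- `N` is a neighbourhood of `f` in the strong (Whitney) `C^r` topology. This topology is finer
than the one of uniform convergence of the derivatives of order at most `r` (take `ε` constant),
and than the one of uniform convergence of these derivatives on compact sets, so all
neighbourhoods for those topologies are included. -/
def IsCrNeighbourhood {r : ℕ} (f : Diff r) (N : Set (Diff r)) : Prop :=
  ∃ ε : E3 → ℝ, Continuous ε ∧ (∀ p, 0 < ε p) ∧ crBall f ε ⊆ N

/-! ### Wandering domains, historic behaviour and Dirac physical measures -/

/-- The forward orbit of `p`; for a periodic point, its periodic orbit. -/
def forwardOrbit (f : E3 → E3) (p : E3) : Set E3 := range fun i : ℕ => f^[i] p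

/-- The `ω`-limit set of the point `x`. -/
def omegaSet (f : E3 → E3) (x : E3) : Set E3 :=
  omegaLimit atTop (fun (i : ℕ) (q : E3) => f^[i] q) {x}

/-- A non-trivial wandering domain: a non-empty connected open set whose forward images are
pairwise disjoint and such that the union of the `ω`-limit sets of its points is not equal to a
single periodic orbit. -/
structure IsWanderingDomain (f : E3 → E3) (D : Set E3) : Prop where
  isOpen : IsOpen D
  isConnected : IsConnected D
  disjoint : ∀ i j : ℕ, i ≠ j → Disjoint (f^[i] '' D) (f^[j] '' D)
  nontrivial : ∀ p ∈ Function.periodicPts f, (⋃ x ∈ D, omegaSet f x) ≠ forwardOrbit f p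

/-- The diameters of the forward images of `D` converge to zero. -/
def IsContracting (f : E3 → E3) (D : Set E3) : Prop :=
  Tendsto (fun i : ℕ => Metric.ediam (f^[i] '' D)) atTop (𝓝 0)

/-- The empirical measure `(n + 1)⁻¹ * ∑_{i = 0}^{n} δ_{f^i(x)}`. -/
def empirical (f : E3 → E3) (x : E3) (n : ℕ) : Measure E3 :=
  ((n : ENNReal) + 1)⁻¹ • ∑ i ∈ Finset.range (n + 1), Measure.dirac (f^[i] x)

/-- Weak* convergence of measures, as functionals on the continuous functions with compact
support. For probability measures converging to a probability measure this is the same as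
convergence against all bounded continuous functions; on the other hand an orbit that merely
escapes to infinity has converging empirical measures (with limit zero). -/
def WeakStarTendsto (μ : ℕ → Measure E3) (ν : Measure E3) : Prop :=
  ∀ φ : E3 → ℝ, Continuous φ → HasCompactSupport φ →
    Tendsto (fun n => ∫ q, φ q ∂(μ n)) atTop (𝓝 (∫ q, φ q ∂ν))

/-- The forward orbit of `x` has historic behaviour: its empirical measures do not converge. -/
def HasHistoricBehaviour (f : E3 → E3) (x : E3) : Prop :=
  ¬ ∃ ν : Measure E3, IsFiniteMeasure ν ∧ WeakStarTendsto (empirical f x) ν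

/-- A historic wandering domain: a non-trivial wandering domain all of whose points have orbits
with historic behaviour. -/
def IsHistoricWanderingDomain (f : E3 → E3) (D : Set E3) : Prop :=
  IsWanderingDomain f D ∧ ∀ x ∈ D, HasHistoricBehaviour f x

/-- `p` is a periodic point of saddle type: with `n` its period, the derivative of `f^n` at `p`
has no complex eigenvalue of modulus one, and it has complex eigenvalues of modulus less than one
as well as of modulus greater than one. -/
def IsSaddlePeriodicPt (f : E3 → E3) (p : E3) : Prop :=
  p ∈ Function.periodicPts f ∧
  let χ : Polynomial ℝ :=
    (fderiv ℝ (f^[Function.minimalPeriod f p]) p : E3 →ₗ[ℝ] E3).charpoly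
  (∀ μ : ℂ, Polynomial.aeval μ χ = 0 → ‖μ‖ ≠ 1) ∧
    (∃ μ : ℂ, Polynomial.aeval μ χ = 0 ∧ ‖μ‖ < 1) ∧
    (∃ μ : ℂ, Polynomial.aeval μ χ = 0 ∧ 1 < ‖μ‖)

/-- `ν` is a non-trivial Dirac physical measure of `f` associated with `D`: a probability measure
whose support is a periodic orbit of saddle type and to which the empirical measures of every
point of `D` converge. -/
def IsNontrivialDiracPhysical (f : E3 → E3) (D : Set E3) (ν : Measure E3) : Prop :=
  IsProbabilityMeasure ν ∧ (∀ x ∈ D, WeakStarTendsto (empirical f x) ν) ∧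
    ∃ p : E3, IsSaddlePeriodicPt f p ∧ ν.support = forwardOrbit f p

/-! ### The explicit model -/

/-- The closed unit cube. -/
def cube : Set E3 := Icc 0 1 ×ˢ (Icc 0 1 ×ˢ Icc 0 1)

/-- The slab `[0, lu⁻¹] × [0, 1]²`. -/
def V0 (lu : ℝ) : Set E3 := Icc 0 lu⁻¹ ×ˢ (Icc 0 1 ×ˢ Icc 0 1)

/-- The slab `[1 - lu⁻¹, 1] × [0, 1]²`. -/
def V1 (lu : ℝ) : Set E3 := Icc (1 - lu⁻¹) 1 ×ˢ (Icc 0 1 ×ˢ Icc 0 1)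

/-- The gap, the part of the cube outside both slabs. -/
def gap (lu : ℝ) : Set E3 := cube \ (V0 lu ∪ V1 lu)

/-- The rates `lss, lcs0, lcs1, lu` of the blender horseshoe and the coefficients
`a1, a2, a3, a4` and width `δ` of the tangency map. -/
structure Params where
  lss : ℝ
  lcs0 : ℝ
  lcs1 : ℝ
  lu : ℝ
  a1 : ℝ
  a2 : ℝ
  a3 : ℝ
  a4 : ℝ
  δ : ℝ

/-- The inequalities imposed on the parameters. -/
structure Params.Admissible (c : Params) : Prop where
  lss_pos : 0 < c.lss
  lss_lt : c.lss < c.lcs0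
  lcs0_lt : c.lcs0 < 1 / 2
  lt_lcs1 : 1 / 2 < c.lcs1
  lcs1_lt : c.lcs1 < 1
  one_lt : 1 < c.lcs0 + c.lcs1
  lt_lu : 2 < c.lu
  dissipative : c.lcs0 * c.lcs1 * c.lu ^ 2 < 1
  lt_a1 : (1 - 2 * c.lu⁻¹)⁻¹ < c.a1
  a2_pos : 0 < c.a2
  a3_ne : c.a3 ≠ 0
  a3_lt : |c.a3| < 1 - 2 * c.lss
  a4_pos : 0 < c.a4
  δ_pos : 0 < c.δ
  δ_lt : c.δ < 1 / 2 - c.lu⁻¹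

/-- `f` is the model: on the two slabs it is the affine skew product over the planar horseshoe
with fibre maps `z ↦ lcs0 * z` and `z ↦ lcs1 * z + (1 - lcs1)`, it maps the gap outside the cube,
and on the `δ`-neighbourhood (in the cube) of the disc `x = 1 / 2` of the gap its second iterate
is the quadratic tangency map. -/
structure IsModel (c : Params) (f : E3 → E3) : Prop where
  on_V0 : ∀ x y z : ℝ, (x, y, z) ∈ V0 c.lu →
    f (x, y, z) = (c.lu * x, c.lss * y, c.lcs0 * z)
  on_V1 : ∀ x y z : ℝ, (x, y, z) ∈ V1 c.lu →
    f (x, y, z) = (c.lu * (1 - x), 1 - c.lss * y, c.lcs1 * z + (1 - c.lcs1))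
  on_gap : ∀ p ∈ gap c.lu, f p ∉ cube
  tangency : ∀ x y z : ℝ, (x, y, z) ∈ gap c.lu → |x - 1 / 2| < c.δ →
    f (f (x, y, z)) =
      (-c.a1 * (x - 1 / 2) ^ 2 + c.a2 * z, c.a3 * (y - 1 / 2) + 1 / 2,
        c.a4 * (x - 1 / 2) + 1 / 2)

end WildBlender

end

/-! Call the two slabs `0` and `1`. The second iterate of the model sends a thin box about `x =
1/2`, at height `h`, to points whose `x`-coordinate is near `a2 * h`, with an error quadratic in the
width of the box. If that coordinate is the starting point `codeX c w (1/2)` of an itinerary `w`,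
following `w` brings the box back to `x = 1/2`. The `x`-direction has been stretched by `lu ^ |w|`,
but starting from an interval of quadratically small length, and the `z`-direction has been
contracted by `rateZ c w`. Hence a box of size `ρ k` in `x` and `ρ k ^ 2` in `z` enters the next one
once `lu ^ n k * (a1 + a2) * ρ k ^ 2 < ρ (k + 1)` and `a4 * ρ k * rateZ < ρ (k + 1) ^ 2`, where `n
k` is the length of the word. Since `lcs0 * lcs1 * lu ^ 2 < 1`, both hold for large `k` with `ρ k =
(lu * τ) ^ (-n k)` and `τ > 1` close to `1`, if the words consist mostly of pairs `00` or `01` and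
`n (k + 1) - n k` is negligible against `n k` (`exists_goodStage`).

The words are `0 ^ k 1 (0 b) ^ (k ^ 3) v`, with `v` of length `k ^ 2`. The images of the fibre maps
overlap because `lcs0 + lcs1 > 1`, so `v` can steer the height to within `lcs1 ^ (k ^ 2)` of the one
needed at the next stage (`exists_codeZ_close`). The remaining mismatch is removed by a translation
in `x` on a region where `lu ^ k * x` is roughly in `[1 - lu⁻¹, 1]`. These regions are disjoint for
different `k`, and a translation by `lcs1 ^ (k ^ 2)` has `C^r` size about `lcs1 ^ (k ^ 2) * lu ^ (k
* r)`, which tends to zero superexponentially. Starting at a late stage therefore makes the whole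
perturbation small (`exists_isPerturbation`). It acts only on the middle strip of `y`, where orbits
arrive from the tangency; after a letter of the word the orbit is outside that strip, so the rest of
the itinerary is undisturbed (`exists_followsWord`).

The boxes lie at different scales in `z`, so the domain never returns. Its orbits accumulate on a
point `(1/2, y, 0)` that is mapped into the invariant part of the plane `x = 0` and is not periodic.
The letters `b` remain free and fill most of the time. Always `0` gives convergence to the Dirac
measure at the saddle `0`; alternating `0` and `1` over eras of geometrically growing length makes
the frequency of visits to the first slab oscillate. -/

namespace WildBlender

/-! ### Words and the fibre maps of the horseshoe -/

/-- The point of the unit interval that follows the itinerary `w` and then lands at `s`. -/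
noncomputable def codeX (c : Params) : List Bool → ℝ → ℝ
  | [], s => s
  | a :: w, s => if a then 1 - codeX c w s / c.lu else codeX c w s / c.lu

/-- The `y`-coordinate after the itinerary `w`. -/
noncomputable def codeY (c : Params) : List Bool → ℝ → ℝ
  | [], y => y
  | a :: w, y => codeY c w (if a then 1 - c.lss * y else c.lss * y)

/-- The `z`-coordinate after the itinerary `w`. -/
noncomputable def codeZ (c : Params) : List Bool → ℝ → ℝ
  | [], z => z
  | a :: w, z => codeZ c w (if a then c.lcs1 * z + (1 - c.lcs1) else c.lcs0 * z)

/-- The contraction rate of `codeZ c w`. -/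
noncomputable def rateZ (c : Params) : List Bool → ℝ
  | [] => 1
  | a :: w => rateZ c w * (if a then c.lcs1 else c.lcs0)

variable {c : Params}

lemma Params.Admissible.lu_pos (hc : c.Admissible) : 0 < c.lu := by linarith [hc.lt_lu]
lemma Params.Admissible.one_lt_lu (hc : c.Admissible) : 1 < c.lu := by linarith [hc.lt_lu]
lemma Params.Admissible.inv_lt (hc : c.Admissible) : c.lu⁻¹ < 1 / 2 := by
  rw [one_div]; exact inv_strictAnti₀ (by norm_num) hc.lt_lu
lemma Params.Admissible.inv_pos (hc : c.Admissible) : 0 < c.lu⁻¹ := _root_.inv_pos.2 hc.lu_pos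
lemma Params.Admissible.lcs0_pos (hc : c.Admissible) : 0 < c.lcs0 := hc.lss_pos.trans hc.lss_lt
lemma Params.Admissible.lcs1_pos (hc : c.Admissible) : 0 < c.lcs1 := by linarith [hc.lt_lcs1]

/-- Words act on `x` through the inverse branches and on `y` and `z` through the forward maps, hence
the opposite orders of composition here and in the next two lemmas. -/
lemma codeX_append (u v : List Bool) (s : ℝ) :
    codeX c (u ++ v) s = codeX c u (codeX c v s) := by
  induction u with
  | nil => rfl
  | cons a u ih => simp [codeX, ih]

lemma codeY_append (u v : List Bool) (s : ℝ) :
    codeY c (u ++ v) s = codeY c v (codeY c u s) := by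
  induction u generalizing s with
  | nil => rfl
  | cons a u ih => simp [codeY, ih]

lemma codeZ_append (u v : List Bool) (s : ℝ) :
    codeZ c (u ++ v) s = codeZ c v (codeZ c u s) := by
  induction u generalizing s with
  | nil => rfl
  | cons a u ih => simp [codeZ, ih]

lemma rateZ_append (u v : List Bool) : rateZ c (u ++ v) = rateZ c u * rateZ c v := by
  induction u with
  | nil => simp [rateZ]
  | cons a u ih => simp only [List.cons_append, rateZ, ih]; ring

lemma codeX_mem (hc : c.Admissible) (w : List Bool) {s : ℝ} (hs : s ∈ Icc (0 : ℝ) 1) :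
    codeX c w s ∈ Icc (0 : ℝ) 1 := by
  induction w with
  | nil => exact hs
  | cons a w ih =>
    have h0 : 0 ≤ codeX c w s / c.lu := div_nonneg ih.1 hc.lu_pos.le
    have h1 : codeX c w s / c.lu ≤ 1 := (div_le_one hc.lu_pos).2 (by linarith [ih.2, hc.lt_lu])
    cases a <;> simp only [codeX, mem_Icc, if_true, Bool.false_eq_true, if_false] <;>
      constructor <;> linarith

lemma codeY_mem (hc : c.Admissible) (w : List Bool) {s : ℝ} (hs : s ∈ Icc (0 : ℝ) 1) :
    codeY c w s ∈ Icc (0 : ℝ) 1 := by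
  induction w generalizing s with
  | nil => exact hs
  | cons a w ih =>
    have h0 : 0 ≤ c.lss * s := mul_nonneg hc.lss_pos.le hs.1
    have h1 : c.lss * s ≤ 1 := mul_le_one₀ (by linarith [hc.lss_lt, hc.lcs0_lt]) hs.1 hs.2
    apply ih
    cases a <;> simp only [mem_Icc, if_true, Bool.false_eq_true, if_false] <;>
      constructor <;> linarith

lemma codeZ_mem (hc : c.Admissible) (w : List Bool) {s : ℝ} (hs : s ∈ Icc (0 : ℝ) 1) :
    codeZ c w s ∈ Icc (0 : ℝ) 1 := by
  induction w generalizing s with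
  | nil => exact hs
  | cons a w ih =>
    have h0 : 0 ≤ c.lcs0 * s := mul_nonneg hc.lcs0_pos.le hs.1
    have h1 : c.lcs0 * s ≤ 1 := mul_le_one₀ (by linarith [hc.lcs0_lt]) hs.1 hs.2
    have h2 : 0 ≤ c.lcs1 * s := mul_nonneg hc.lcs1_pos.le hs.1
    have h3 : c.lcs1 * s ≤ c.lcs1 := mul_le_of_le_one_right hc.lcs1_pos.le hs.2
    have h4 := hc.lcs1_lt
    apply ih
    cases a <;> simp only [mem_Icc, if_true, Bool.false_eq_true, if_false] <;>
      constructor <;> linarith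

lemma abs_codeX_sub (hc : c.Admissible) (w : List Bool) (s t : ℝ) :
    |codeX c w s - codeX c w t| = |s - t| / c.lu ^ w.length := by
  induction w with
  | nil => simp [codeX]
  | cons a w ih =>
    have : |codeX c w s / c.lu - codeX c w t / c.lu| = |s - t| / c.lu ^ (w.length + 1) := by
      rw [← sub_div, abs_div, ih, abs_of_pos hc.lu_pos, pow_succ, div_div]
    cases a
    · simpa [codeX] using this
    · simp only [codeX, if_true, List.length_cons]
      rw [← this, abs_sub_comm (codeX c w s / c.lu)]
      congr 1; ring

/-- The composed inverse branch is an affine bijection of the line. It yields a landing coordinate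
for any starting point, to be located in the unit interval afterwards. -/
lemma codeX_surjective (hc : c.Admissible) (w : List Bool) :
    Function.Surjective (codeX c w) := by
  have h := hc.lu_pos.ne'
  induction w with
  | nil => exact fun x => ⟨x, rfl⟩
  | cons a w ih =>
    intro x
    cases a
    · obtain ⟨s, hs⟩ := ih (x * c.lu)
      exact ⟨s, by simp [codeX, hs, h]⟩
    · obtain ⟨s, hs⟩ := ih ((1 - x) * c.lu)
      exact ⟨s, by simp [codeX, hs, h]⟩

lemma abs_codeY_sub (hc : c.Admissible) (w : List Bool) (s t : ℝ) :
    |codeY c w s - codeY c w t| = c.lss ^ w.length * |s - t| := by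
  induction w generalizing s t with
  | nil => simp [codeY]
  | cons a w ih =>
    have h : |c.lss * s - c.lss * t| = c.lss * |s - t| := by
      rw [← mul_sub, abs_mul, abs_of_pos hc.lss_pos]
    cases a
    · simp only [codeY, Bool.false_eq_true, if_false, List.length_cons]
      rw [ih, h]; ring
    · simp only [codeY, if_true, List.length_cons]
      rw [ih, show 1 - c.lss * s - (1 - c.lss * t) = -(c.lss * s - c.lss * t) by ring, abs_neg, h]
      ring

lemma abs_codeZ_sub (hc : c.Admissible) (w : List Bool) (s t : ℝ) :
    |codeZ c w s - codeZ c w t| = rateZ c w * |s - t| := by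
  induction w generalizing s t with
  | nil => simp [codeZ, rateZ]
  | cons a w ih =>
    cases a
    · simp only [codeZ, rateZ, Bool.false_eq_true, if_false]
      rw [ih, ← mul_sub, abs_mul, abs_of_pos hc.lcs0_pos]; ring
    · simp only [codeZ, rateZ, if_true]
      rw [ih, add_sub_add_right_eq_sub, ← mul_sub, abs_mul, abs_of_pos hc.lcs1_pos]; ring

lemma rateZ_pos (hc : c.Admissible) (w : List Bool) : 0 < rateZ c w := by
  induction w with
  | nil => simp [rateZ]
  | cons a w ih => cases a <;> simp [rateZ, ih, hc.lcs0_pos, hc.lcs1_pos]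

lemma rateZ_le_one (hc : c.Admissible) (w : List Bool) : rateZ c w ≤ 1 := by
  induction w with
  | nil => simp [rateZ]
  | cons a w ih =>
    cases a
    · exact mul_le_one₀ ih (by simpa using hc.lcs0_pos.le) (by
        simpa using hc.lcs0_lt.le.trans (by norm_num))
    · exact mul_le_one₀ ih (by simpa using hc.lcs1_pos.le) (by simpa using hc.lcs1_lt.le)

/-- The overlap of the fibre maps: every height is reached by words of any given length. -/
lemma exists_codeZ_close (hc : c.Admissible) (L : ℕ) {t : ℝ} (ht : t ∈ Icc (0 : ℝ) 1) :
    ∃ v : List Bool, v.length = L ∧ ∀ s ∈ Icc (0 : ℝ) 1, |codeZ c v s - t| ≤ c.lcs1 ^ L := by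
  induction L generalizing t with
  | zero =>
    refine ⟨[], rfl, fun s hs => ?_⟩
    simp only [codeZ, pow_zero, abs_le]
    constructor <;> linarith [hs.1, hs.2, ht.1, ht.2]
  | succ L ih =>
    have h0 := hc.lcs0_pos
    have h1 := hc.lcs1_pos
    have h01 : c.lcs0 ≤ c.lcs1 := by linarith [hc.lcs0_lt, hc.lt_lcs1]
    -- The intervals `[0, lcs0]` and `[1 - lcs1, 1]` cover `[0, 1]` since `lcs0 + lcs1 > 1`. The
    -- last letter is chosen so that its image contains `t`, and the word before it steers to the
    -- preimage of `t`.
    rcases le_total t c.lcs0 with h | h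
    · obtain ⟨v, hv, hv'⟩ := ih (t := t / c.lcs0)
        ⟨div_nonneg ht.1 h0.le, (div_le_one h0).2 h⟩
      refine ⟨v ++ [false], by simp [hv], fun s hs => ?_⟩
      have e : codeZ c (v ++ [false]) s - t = c.lcs0 * (codeZ c v s - t / c.lcs0) := by
        rw [codeZ_append]; simp only [codeZ]; simp; field_simp
      rw [e, abs_mul, abs_of_pos h0, pow_succ, mul_comm]
      exact mul_le_mul (hv' s hs) h01 h0.le (by positivity)
    · obtain ⟨v, hv, hv'⟩ := ih (t := (t - (1 - c.lcs1)) / c.lcs1)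
        ⟨div_nonneg (by linarith [hc.one_lt]) h1.le, (div_le_one h1).2 (by linarith [ht.2])⟩
      refine ⟨v ++ [true], by simp [hv], fun s hs => ?_⟩
      have e : codeZ c (v ++ [true]) s - t
          = c.lcs1 * (codeZ c v s - (t - (1 - c.lcs1)) / c.lcs1) := by
        rw [codeZ_append]; simp only [codeZ]; simp; field_simp; ring
      rw [e, abs_mul, abs_of_pos h1, pow_succ, mul_comm]
      exact mul_le_mul_of_nonneg_right (hv' s hs) h1.le

lemma codeX_mem_V0 (hc : c.Admissible) (w : List Bool) {s y z : ℝ} (hs : s ∈ Icc (0 : ℝ) 1)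
    (hy : y ∈ Icc (0 : ℝ) 1) (hz : z ∈ Icc (0 : ℝ) 1) :
    (codeX c (false :: w) s, y, z) ∈ V0 c.lu := by
  have h := codeX_mem hc w hs
  refine ⟨⟨?_, ?_⟩, hy, hz⟩
  · simpa [codeX] using div_nonneg h.1 hc.lu_pos.le
  · simp only [codeX, Bool.false_eq_true, if_false, div_eq_mul_inv]
    exact mul_le_of_le_one_left hc.inv_pos.le h.2

lemma codeX_mem_V1 (hc : c.Admissible) (w : List Bool) {s y z : ℝ} (hs : s ∈ Icc (0 : ℝ) 1)
    (hy : y ∈ Icc (0 : ℝ) 1) (hz : z ∈ Icc (0 : ℝ) 1) :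
    (codeX c (true :: w) s, y, z) ∈ V1 c.lu := by
  have h := codeX_mem hc w hs
  have h0 := div_nonneg h.1 hc.lu_pos.le
  have h1 : codeX c w s / c.lu ≤ c.lu⁻¹ := by
    rw [div_eq_mul_inv]; exact mul_le_of_le_one_left hc.inv_pos.le h.2
  refine ⟨⟨?_, ?_⟩, hy, hz⟩ <;> simp only [codeX, if_true] <;> linarith

/-! ### Orbits of the model along words -/

variable {f : E3 → E3}

lemma IsModel.apply_code (hc : c.Admissible) (hf : IsModel c f) (a : Bool) (w : List Bool)
    {s y z : ℝ} (hs : s ∈ Icc (0 : ℝ) 1) (hy : y ∈ Icc (0 : ℝ) 1) (hz : z ∈ Icc (0 : ℝ) 1) :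
    f (codeX c (a :: w) s, y, z) = (codeX c w s, codeY c [a] y, codeZ c [a] z) := by
  have h := hc.lu_pos.ne'
  cases a
  · rw [hf.on_V0 _ _ _ (codeX_mem_V0 hc w hs hy hz)]
    simp [codeX, codeY, codeZ]; field_simp
  · rw [hf.on_V1 _ _ _ (codeX_mem_V1 hc w hs hy hz)]
    simp [codeX, codeY, codeZ]; field_simp

lemma IsModel.iterate_code (hc : c.Admissible) (hf : IsModel c f) (w u : List Bool)
    {s y z : ℝ} (hs : s ∈ Icc (0 : ℝ) 1) (hy : y ∈ Icc (0 : ℝ) 1) (hz : z ∈ Icc (0 : ℝ) 1) :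
    f^[w.length] (codeX c (w ++ u) s, y, z) = (codeX c u s, codeY c w y, codeZ c w z) := by
  induction w generalizing y z with
  | nil => rfl
  | cons a w ih =>
    rw [List.length_cons, Function.iterate_succ_apply, List.cons_append,
      hf.apply_code hc a _ hs hy hz, ih (codeY_mem hc _ hy) (codeZ_mem hc _ hz)]
    rfl

lemma IsModel.iterate_code_take (hc : c.Admissible) (hf : IsModel c f) (w : List Bool) {j : ℕ}
    (hj : j ≤ w.length) {s y z : ℝ} (hs : s ∈ Icc (0 : ℝ) 1) (hy : y ∈ Icc (0 : ℝ) 1)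
    (hz : z ∈ Icc (0 : ℝ) 1) :
    f^[j] (codeX c w s, y, z)
      = (codeX c (w.drop j) s, codeY c (w.take j) y, codeZ c (w.take j) z) := by
  have := hf.iterate_code hc (w.take j) (w.drop j) hs hy hz
  rwa [List.take_append_drop, List.length_take, min_eq_left hj] at this

/-- Points of `f (V0 ∪ V1)` avoid the middle of the cube. -/
lemma codeY_not_mem_middle (hc : c.Admissible) {w : List Bool} (hw : w ≠ []) {y : ℝ}
    (hy : y ∈ Icc (0 : ℝ) 1) : codeY c w y ∉ Ioo c.lss (1 - c.lss) := by
  rw [← List.dropLast_append_getLast hw, codeY_append]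
  have h := codeY_mem hc w.dropLast hy
  have h0 : c.lss * codeY c w.dropLast y ≤ c.lss := mul_le_of_le_one_right hc.lss_pos.le h.2
  generalize w.getLast hw = a
  rintro ⟨h1, h2⟩
  cases a <;> simp [codeY] at h1 h2 <;> linarith

/-! ### Perturbations supported in the first slab -/

/-- The margin around the interval `[1 - lu⁻¹, 1]` in which perturbations are constant. -/
noncomputable def Params.margin (c : Params) : ℝ := (1 - 2 * c.lu⁻¹) / 8

lemma Params.Admissible.margin_pos (hc : c.Admissible) : 0 < c.margin := by
  have := hc.inv_lt
  unfold Params.margin; linarith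

lemma Params.Admissible.margin_le (hc : c.Admissible) : c.margin ≤ 1 / 8 := by
  have := hc.inv_pos
  unfold Params.margin; linarith

/-- The map `(x, y, z) ↦ (lu ^ k * x, y, z)`. -/
noncomputable def scale (c : Params) (k : ℕ) : E3 →L[ℝ] E3 :=
  (c.lu ^ k • ContinuousLinearMap.fst ℝ ℝ (ℝ × ℝ)).prod (ContinuousLinearMap.snd ℝ ℝ (ℝ × ℝ))

lemma scale_apply (k : ℕ) (p : E3) : scale c k p = (c.lu ^ k * p.1, p.2) := by
  simp [scale]

lemma norm_scale_le (hc : c.Admissible) (k : ℕ) : ‖scale c k‖ ≤ c.lu ^ k := by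
  have h1 : 1 ≤ c.lu ^ k := one_le_pow₀ hc.one_lt_lu.le
  refine ContinuousLinearMap.opNorm_le_bound _ (by positivity) fun p => ?_
  rw [scale_apply, Prod.norm_def, Prod.norm_def]
  refine max_le ?_ ?_
  · rw [norm_mul, Real.norm_of_nonneg (by positivity : 0 ≤ c.lu ^ k)]
    exact mul_le_mul_of_nonneg_left (le_max_left _ _) (by positivity)
  · exact (le_max_right _ _).trans (le_mul_of_one_le_left (by positivity) h1)

/-- A bump function equal to one on the region through which the orbits of the wandering domains
return. -/
structure IsReturnBump (c : Params) (H : E3 → ℝ) : Prop where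
  contDiff : ∀ n : ℕ, ContDiff ℝ n H
  compact : HasCompactSupport H
  le_one : ∀ p, |H p| ≤ 1
  support : ∀ x y z, H (x, y, z) ≠ 0 → x ∈ Ioo (1 - c.lu⁻¹ - 2 * c.margin) (1 + 2 * c.margin) ∧
    y ∈ Ioo c.lss (1 - c.lss) ∧ z ∈ Ioo (0 : ℝ) 1
  one : ∀ x y z, x ∈ Icc (1 - c.lu⁻¹ - c.margin) (1 + c.margin) →
    y ∈ Icc (1 / 2 - |c.a3| / 2) (1 / 2 + |c.a3| / 2) → z ∈ Icc (1 / 4 : ℝ) (3 / 4) →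
    H (x, y, z) = 1

/-- A product of three bumps in one variable. In `y` there is room for the transition because `|a3|
/ 2 < 1 / 2 - lss`. -/
lemma exists_isReturnBump (hc : c.Admissible) : ∃ H, IsReturnBump c H := by
  have hm := hc.margin_pos
  have hi := hc.inv_pos
  have h3 := hc.a3_lt
  have h3' := abs_pos.2 hc.a3_ne
  let bx : ContDiffBump (1 - c.lu⁻¹ / 2) :=
    ⟨c.lu⁻¹ / 2 + c.margin, c.lu⁻¹ / 2 + 2 * c.margin, by positivity, by linarith⟩
  let by' : ContDiffBump (1 / 2 : ℝ) :=
    ⟨|c.a3| / 2, 1 / 2 - c.lss, by positivity, by linarith⟩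
  let bz : ContDiffBump (1 / 2 : ℝ) := ⟨1 / 4, 1 / 2, by norm_num, by norm_num⟩
  have key : ∀ {m : ℝ} (b : ContDiffBump m) {x : ℝ}, b x ≠ 0 → x ∈ Ioo (m - b.rOut) (m + b.rOut) := by
    intro m b x hx
    have : x ∈ Function.support b := hx
    rwa [b.support_eq, Real.ball_eq_Ioo] at this
  have key1 : ∀ {m : ℝ} (b : ContDiffBump m) {x : ℝ}, x ∈ Icc (m - b.rIn) (m + b.rIn) → b x = 1 := by
    intro m b x hx
    exact b.one_of_mem_closedBall (by rwa [Real.closedBall_eq_Icc])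
  refine ⟨fun p => bx p.1 * (by' p.2.1 * bz p.2.2), ?_, ?_, ?_, ?_, ?_⟩
  · intro n
    exact (bx.contDiff.comp contDiff_fst).mul ((by'.contDiff.comp
      (contDiff_fst.comp contDiff_snd)).mul (bz.contDiff.comp (contDiff_snd.comp contDiff_snd)))
  · refine HasCompactSupport.intro (K := Metric.closedBall (1 - c.lu⁻¹ / 2) bx.rOut ×ˢ
      (Metric.closedBall (1 / 2) by'.rOut ×ˢ Metric.closedBall (1 / 2) bz.rOut))
      ((isCompact_closedBall _ _).prod ((isCompact_closedBall _ _).prod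
        (isCompact_closedBall _ _))) ?_
    rintro ⟨x, y, z⟩ hp
    by_contra h
    simp only [mul_ne_zero_iff, ne_eq] at h
    refine hp ⟨?_, ?_, ?_⟩ <;> rw [Real.closedBall_eq_Icc]
    · exact Ioo_subset_Icc_self (key bx h.1)
    · exact Ioo_subset_Icc_self (key by' h.2.1)
    · exact Ioo_subset_Icc_self (key bz h.2.2)
  · intro p
    rw [abs_of_nonneg (mul_nonneg bx.nonneg (mul_nonneg by'.nonneg bz.nonneg))]
    exact mul_le_one₀ bx.le_one (mul_nonneg by'.nonneg bz.nonneg)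
      (mul_le_one₀ by'.le_one bz.nonneg bz.le_one)
  · intro x y z h
    simp only [mul_ne_zero_iff, ne_eq] at h
    have h1 := key bx h.1
    have h2 := key by' h.2.1
    have h3 := key bz h.2.2
    simp only [mem_Ioo, bx, by', bz] at h1 h2 h3 ⊢
    refine ⟨⟨?_, ?_⟩, ⟨?_, ?_⟩, ?_, ?_⟩ <;> linarith
  · intro x y z h1 h2 h3
    simp only [mem_Icc] at h1 h2 h3
    have e1 : bx x = 1 := key1 bx ⟨by simp only [bx]; linarith, by simp only [bx]; linarith⟩
    have e2 : by' y = 1 := key1 by' ⟨by simp only [by']; linarith, by simp only [by']; linarith⟩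
    have e3 : bz z = 1 := key1 bz ⟨by simp only [bz]; linarith, by simp only [bz]; linarith⟩
    simp [e1, e2, e3]

/-- A perturbation of the identity by a map with small derivative is a diffeomorphism. -/
lemma exists_diff_of_norm_fderiv_le {r : ℕ} (hr : 1 ≤ r) {h : E3 → E3} (hh : ContDiff ℝ r h)
    (hd : ∀ p, ‖fderiv ℝ h p‖ ≤ 1 / 2) : ∃ Φ : Diff r, ∀ p, Φ p = p + h p := by
  have hr' : ((r : ℕ) : WithTop ℕ∞) ≠ 0 := by
    have : r ≠ 0 := by omega
    exact_mod_cast this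
  have hdiff : Differentiable ℝ h := hh.differentiable hr'
  have hlip : LipschitzWith (1 / 2) h :=
    lipschitzWith_of_nnnorm_fderiv_le hdiff fun p => by
      rw [← NNReal.coe_le_coe]; simpa using hd p
  have happ : ApproximatesLinearOn (fun p => p + h p)
      ((ContinuousLinearEquiv.refl ℝ E3 : E3 ≃L[ℝ] E3) : E3 →L[ℝ] E3) univ (1 / 2) := by
    intro p _ q _
    have := hlip.norm_sub_le p q
    simpa [add_sub_add_comm] using this
  have hlt : (1 / 2 : NNReal) <
      ‖(((ContinuousLinearEquiv.refl ℝ E3).symm : E3 ≃L[ℝ] E3) : E3 →L[ℝ] E3)‖₊⁻¹ := by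
    have : ‖(((ContinuousLinearEquiv.refl ℝ E3).symm : E3 ≃L[ℝ] E3) : E3 →L[ℝ] E3)‖₊ = 1 := by
      simp
    rw [this, inv_one, ← NNReal.coe_lt_coe]; norm_num
  -- The map is within Lipschitz distance `1/2 < 1` of the identity, which gives a global inverse.
  -- Invertibility of its derivative by the Neumann series then makes the inverse `C^r`.
  let e := happ.toHomeomorph (fun p => p + h p) (Or.inr hlt)
  have he : ∀ p, e p = p + h p := fun p => rfl
  have hcd : ContDiff ℝ r e := contDiff_id.add hh
  have hsmall : ∀ p, ‖-fderiv ℝ h p‖ < 1 := fun p => by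
    rw [norm_neg]; exact (hd p).trans_lt (by norm_num)
  have hsymm : ContDiff ℝ r e.symm := by
    refine e.contDiff_symm
      (f₀' := fun p => ContinuousLinearEquiv.ofUnit (Units.oneSub _ (hsmall p))) ?_ hcd
    intro p
    have : HasFDerivAt e (ContinuousLinearMap.id ℝ E3 + fderiv ℝ h p) p :=
      (hasFDerivAt_id p).add (hdiff p).hasFDerivAt
    refine this.congr_fderiv ?_
    refine ContinuousLinearMap.ext fun q => ?_
    change _ = (1 - -fderiv ℝ h p : E3 →L[ℝ] E3) q
    simp
  exact ⟨⟨e.toEquiv, hcd.contMDiff, hsymm.contMDiff⟩, he⟩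

/-- `g` is `f` precomposed with the translation by `(E k, 0, 0)` on the `k`-th return region, and
equal to `f` away from the middle of the first slab. -/
structure IsPerturbation (c : Params) (f g : E3 → E3) (E : ℕ → ℝ) : Prop where
  of_notMem : ∀ p ∉ V0 c.lu, g p = f p
  of_edge : ∀ x y z, y ∉ Ioo c.lss (1 - c.lss) → g (x, y, z) = f (x, y, z)
  of_zero : ∀ y z, g (0, y, z) = f (0, y, z)
  shift : ∀ k x y z, c.lu ^ k * x ∈ Icc (1 - c.lu⁻¹ - c.margin) (1 + c.margin) →
    y ∈ Icc (1 / 2 - |c.a3| / 2) (1 / 2 + |c.a3| / 2) → z ∈ Icc (1 / 4 : ℝ) (3 / 4) →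
    g (x, y, z) = f (x + E k, y, z)

/-- Raising the scale multiplies the lower end `1 - lu⁻¹ - 2 * margin` by at least `lu`, giving at
least `3 * lu / 4 - 1 / 2`. The upper end is at most `lu / 4 + 1 / 2`, which is smaller as `lu > 2`;
this is what the choice of `margin` is for. -/
lemma scale_disjoint (hc : c.Admissible) {j k : ℕ} (hjk : k < j) {x : ℝ}
    (hj : c.lu ^ j * x < 1 + 2 * c.margin) (hk : 1 - c.lu⁻¹ - 2 * c.margin < c.lu ^ k * x) :
    False := by
  have hl := hc.one_lt_lu
  have hi := hc.inv_lt
  have hm := hc.margin_le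
  have hm' := hc.margin_pos
  have hpos : 0 < c.lu ^ k * x := by linarith
  have h1 : c.lu * (c.lu ^ k * x) ≤ c.lu ^ j * x := by
    obtain ⟨d, rfl⟩ := Nat.exists_eq_add_of_lt hjk
    have : 1 ≤ c.lu ^ d := one_le_pow₀ hl.le
    calc c.lu * (c.lu ^ k * x) ≤ c.lu ^ d * (c.lu * (c.lu ^ k * x)) :=
          le_mul_of_one_le_left (by have := hc.lu_pos; positivity) this
      _ = _ := by ring
  have h2 : c.lu * (1 - c.lu⁻¹ - 2 * c.margin) < c.lu * (c.lu ^ k * x) :=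
    mul_lt_mul_of_pos_left hk hc.lu_pos
  have h3 : c.lu * c.lu⁻¹ = 1 := mul_inv_cancel₀ hc.lu_pos.ne'
  have h4 : c.lu * c.margin = (c.lu - 2) / 8 := by
    unfold Params.margin; linear_combination (-1 / 4 : ℝ) * h3
  have h5 : c.margin ≤ c.lu * c.margin := le_mul_of_one_le_left hm'.le hl.le
  nlinarith [hc.lt_lu]

/-! ### The displacement field and its derivatives -/

section

variable {H : E3 → ℝ} {E : ℕ → ℝ}

lemma IsReturnBump.eq_zero_of_ne (hc : c.Admissible) (hH : IsReturnBump c H) {j k : ℕ}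
    (hjk : j ≠ k) {p : E3} (hk : H (scale c k p) ≠ 0) : H (scale c j p) = 0 := by
  by_contra hj
  rw [scale_apply] at hj hk
  have h1 := (hH.support _ _ _ hj).1
  have h2 := (hH.support _ _ _ hk).1
  rcases hjk.lt_or_gt with h | h
  · exact scale_disjoint hc h h2.2 h1.1
  · exact scale_disjoint hc h h1.2 h2.1

/-- The displacement in the `x`-direction. -/
noncomputable def displacement (c : Params) (H : E3 → ℝ) (E : ℕ → ℝ) (p : E3) : ℝ :=
  ∑' k, E k * H (scale c k p)

lemma IsReturnBump.displacement_eq (hc : c.Admissible) (hH : IsReturnBump c H) {k : ℕ} {p : E3}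
    (hk : H (scale c k p) ≠ 0) : displacement c H E p = E k * H (scale c k p) :=
  tsum_eq_single k fun j hj => by rw [hH.eq_zero_of_ne hc hj hk, mul_zero]

lemma exists_of_displacement_ne_zero {p : E3} (h : displacement c H E p ≠ 0) :
    ∃ k, E k ≠ 0 ∧ H (scale c k p) ≠ 0 := by
  by_contra! hk
  refine h ?_
  rw [displacement, ← tsum_zero (α := ℝ) (β := ℕ)]
  refine tsum_congr fun k => ?_
  by_cases h : E k = 0
  · simp [h]
  · rw [hk k h, mul_zero]

/-- Each derivative of the rescaled bump costs one factor `‖scale c k‖ ≤ lu ^ k`; the derivatives of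
`H` itself are bounded by compact support. -/
lemma IsReturnBump.exists_bound (hc : c.Admissible) (hH : IsReturnBump c H) (r : ℕ) :
    ∃ S : ℝ, 0 < S ∧ ∀ i ≤ r, ∀ k p,
      ‖iteratedFDeriv ℝ i (fun q => H (scale c k q)) p‖ ≤ S * (c.lu ^ k) ^ r := by
  have h1 : ∀ i : ℕ, ∃ S : ℝ, ∀ p, ‖iteratedFDeriv ℝ i H p‖ ≤ S := by
    intro i
    have hcont : Continuous (iteratedFDeriv ℝ i H) :=
      (hH.contDiff i).continuous_iteratedFDeriv le_rfl
    exact hcont.bounded_above_of_compact_support (hH.compact.iteratedFDeriv i)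
  choose S hS using h1
  have hpos : ∀ i, 0 ≤ S i := fun i => (norm_nonneg _).trans (hS i 0)
  refine ⟨1 + ∑ i ∈ Finset.range (r + 1), S i, by
    have := Finset.sum_nonneg (s := Finset.range (r + 1)) fun i _ => hpos i
    linarith, fun i hi k p => ?_⟩
  have h1 : 1 ≤ c.lu ^ k := one_le_pow₀ hc.one_lt_lu.le
  have hle : S i ≤ 1 + ∑ i ∈ Finset.range (r + 1), S i := by
    have := Finset.single_le_sum (f := S) (fun i _ => hpos i)
      (Finset.mem_range.2 (Nat.lt_succ_of_le hi))
    linarith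
  have e : (fun q => H (scale c k q)) = H ∘ scale c k := rfl
  rw [e, (scale c k).iteratedFDeriv_comp_right (hH.contDiff i) p le_rfl]
  refine (ContinuousMultilinearMap.norm_compContinuousLinearMap_le _ _).trans ?_
  rw [Finset.prod_const, Finset.card_univ, Fintype.card_fin]
  refine mul_le_mul ((hS i _).trans hle) ?_ (by positivity) ((hpos i).trans hle)
  exact (pow_le_pow_left₀ (norm_nonneg _) (norm_scale_le hc k) i).trans (pow_le_pow_right₀ h1 hi)

/-- The supports accumulate on `x = 0`, so smoothness there is not automatic. The factor `2 ^ k` in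
the hypothesis dominates all derivatives up to order `r` by a geometric series, which permits
termwise differentiation. -/
lemma IsReturnBump.displacement_small (hH : IsReturnBump c H) {r : ℕ}
    {S η : ℝ} (hS0 : 0 < S) (hS : ∀ i ≤ r, ∀ k p,
      ‖iteratedFDeriv ℝ i (fun q => H (scale c k q)) p‖ ≤ S * (c.lu ^ k) ^ r)
    (hE : ∀ k, |E k| * (c.lu ^ k) ^ r * 2 ^ k ≤ η) :
    ContDiff ℝ r (displacement c H E) ∧
      ∀ i ≤ r, ∀ p, ‖iteratedFDeriv ℝ i (displacement c H E) p‖ ≤ 2 * S * η := by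
  have hsm : ∀ (n : ℕ) k, ContDiff ℝ n (fun q => H (scale c k q)) := fun n k =>
    (hH.contDiff n).comp (scale c k).contDiff
  have hcd : ∀ (n : ℕ) k, ContDiff ℝ n (fun q => E k * H (scale c k q)) := fun n k =>
    contDiff_const.mul (hsm n k)
  have hb : ∀ i ≤ r, ∀ k p,
      ‖iteratedFDeriv ℝ i (fun q => E k * H (scale c k q)) p‖ ≤ S * η * (1 / 2) ^ k := by
    intro i hi k p
    have e : (fun q => E k * H (scale c k q)) = E k • fun q => H (scale c k q) := rfl
    rw [e, iteratedFDeriv_const_smul_apply (hsm i k).contDiffAt, norm_smul, Real.norm_eq_abs]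
    calc |E k| * ‖iteratedFDeriv ℝ i (fun q => H (scale c k q)) p‖
        ≤ |E k| * (S * (c.lu ^ k) ^ r) := mul_le_mul_of_nonneg_left (hS i hi k p) (abs_nonneg _)
      _ = S * (|E k| * (c.lu ^ k) ^ r * 2 ^ k) * (1 / 2) ^ k := by
          rw [one_div, inv_pow]; field_simp
      _ ≤ _ := by gcongr; exact hE k
  have hsum : Summable fun k : ℕ => S * η * (1 / 2 : ℝ) ^ k :=
    summable_geometric_two.mul_left _
  have hcast : ∀ i : ℕ, (i : ℕ∞) ≤ ((r : ℕ) : ℕ∞) → i ≤ r := fun i hi => by exact_mod_cast hi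
  have h1 := contDiff_tsum (𝕜 := ℝ) (N := (r : ℕ∞)) (f := fun k q => E k * H (scale c k q))
    (v := fun _ k => S * η * (1 / 2) ^ k) (fun k => hcd r k) (fun _ _ => hsum)
    (fun i k p hi => hb i (hcast i hi) k p)
  refine ⟨h1, fun i hi p => ?_⟩
  have h2 := iteratedFDeriv_tsum_apply (𝕜 := ℝ) (N := (r : ℕ∞))
    (f := fun k q => E k * H (scale c k q))
    (v := fun _ k => S * η * (1 / 2) ^ k) (fun k => hcd r k) (fun _ _ => hsum)
    (fun i k p hi => hb i (hcast i hi) k p) (k := i) (by exact_mod_cast hi) p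
  change ‖iteratedFDeriv ℝ i (fun q => ∑' k, E k * H (scale c k q)) p‖ ≤ _
  rw [h2]
  refine tsum_of_norm_bounded ?_ fun k => hb i hi k p
  have := (hasSum_geometric_two).mul_left (S * η)
  rwa [show S * η * 2 = 2 * S * η by ring] at this

/-- The displacement as a vector field. -/
noncomputable def shiftField (c : Params) (H : E3 → ℝ) (E : ℕ → ℝ) (p : E3) : E3 :=
  ContinuousLinearMap.inl ℝ ℝ (ℝ × ℝ) (displacement c H E p)

lemma norm_iteratedFDeriv_inl_comp_le {u : E3 → ℝ} {i : ℕ} (hu : ContDiff ℝ i u) (p : E3) :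
    ‖iteratedFDeriv ℝ i (fun q => ContinuousLinearMap.inl ℝ ℝ (ℝ × ℝ) (u q)) p‖
      ≤ ‖iteratedFDeriv ℝ i u p‖ := by
  have e : (fun q => ContinuousLinearMap.inl ℝ ℝ (ℝ × ℝ) (u q))
    = ContinuousLinearMap.inl ℝ ℝ (ℝ × ℝ) ∘ u := rfl
  rw [e, (ContinuousLinearMap.inl ℝ ℝ (ℝ × ℝ)).iteratedFDeriv_comp_left hu.contDiffAt le_rfl]
  refine (ContinuousLinearMap.norm_compContinuousMultilinearMap_le _ _).trans ?_
  exact mul_le_of_le_one_left (norm_nonneg _) (ContinuousLinearMap.norm_inl_le_one ℝ ℝ (ℝ × ℝ))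

/-- A point moved by the perturbation stays in the interior of the first slab. -/
lemma IsReturnBump.mem_V0_of_displacement_ne_zero (hc : c.Admissible) (hH : IsReturnBump c H)
    (hE0 : E 0 = 0) (hE1 : E 1 = 0) (hE : ∀ k, |E k| * c.lu ^ k ≤ 1 / 4) {x y z : ℝ}
    (h : displacement c H E (x, y, z) ≠ 0) :
    0 < x ∧ (x, y, z) ∈ V0 c.lu ∧ (x + displacement c H E (x, y, z), y, z) ∈ V0 c.lu ∧
      y ∈ Ioo c.lss (1 - c.lss) := by
  obtain ⟨k, hEk, hk⟩ := exists_of_displacement_ne_zero h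
  have hk2 : 2 ≤ k := by
    by_contra hlt
    interval_cases k
    · exact hEk hE0
    · exact hEk hE1
  rw [hH.displacement_eq hc hk]
  have hs := hk
  rw [scale_apply] at hs
  obtain ⟨⟨hx1, hx2⟩, hy, hz⟩ := hH.support _ _ _ hs
  have hm := hc.margin_le
  have hi := hc.inv_lt
  have hlk : 0 < c.lu ^ k := pow_pos hc.lu_pos k
  -- For `k ≥ 2` one has `lu ^ 2 * u < 2 < lu`, so `u < lu⁻¹`. The regions of index `0` and `1` are
  -- not contained in the slab, which is why `E 0` and `E 1` must vanish.
  have hslab : ∀ u : ℝ, 0 < c.lu ^ k * u → c.lu ^ k * u < 2 → u ∈ Icc 0 c.lu⁻¹ := by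
    intro u h0 h2
    have hu : 0 < u := pos_of_mul_pos_right h0 hlk.le
    refine ⟨hu.le, ?_⟩
    have h3 : c.lu ^ 2 * u ≤ c.lu ^ k * u :=
      mul_le_mul_of_nonneg_right (pow_le_pow_right₀ hc.one_lt_lu.le hk2) hu.le
    have h4 : c.lu * (u * c.lu) < c.lu * 1 := by
      calc c.lu * (u * c.lu) = c.lu ^ 2 * u := by ring
        _ < c.lu * 1 := by linarith [hc.lt_lu]
    have h5 := lt_of_mul_lt_mul_left h4 hc.lu_pos.le
    rw [le_inv_comm₀ hu hc.lu_pos, ← one_div, le_div_iff₀ hu, mul_comm]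
    exact h5.le
  have hd : |c.lu ^ k * (E k * H (scale c k (x, y, z)))| ≤ 1 / 4 := by
    rw [abs_mul, abs_mul, abs_of_pos hlk]
    calc c.lu ^ k * (|E k| * |H (scale c k (x, y, z))|)
        ≤ c.lu ^ k * (|E k| * 1) := by gcongr; exact hH.le_one _
      _ = |E k| * c.lu ^ k := by ring
      _ ≤ _ := hE k
  obtain ⟨hd1, hd2⟩ := abs_le.1 hd
  simp only at hx1 hx2 hy hz
  have hyI : y ∈ Icc (0 : ℝ) 1 := ⟨by linarith [hy.1, hc.lss_pos], by linarith [hy.2, hc.lss_pos]⟩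
  refine ⟨pos_of_mul_pos_right (by linarith : 0 < c.lu ^ k * x) hlk.le,
    ⟨hslab x (by linarith) (by linarith), hyI, Ioo_subset_Icc_self hz⟩,
    ⟨hslab _ ?_ ?_, hyI, Ioo_subset_Icc_self hz⟩, hy⟩ <;> rw [mul_add] <;> linarith

end

/-! ### Closeness of the perturbed map in the strong topology -/

lemma diff_contDiff {r : ℕ} (f : Diff r) : ContDiff ℝ r f := f.contMDiff_toFun.contDiff

lemma isCompact_cube : IsCompact cube := isCompact_Icc.prod (isCompact_Icc.prod isCompact_Icc)

lemma V0_subset_cube (hc : c.Admissible) : V0 c.lu ⊆ cube :=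
  prod_mono (Icc_subset_Icc le_rfl (by linarith [hc.inv_lt])) subset_rfl

/-- The perturbed map is `f` after `id + shiftField`. Moved points stay in the first slab, where `f`
is affine with slope `lu` in `x`, so the difference of the two maps is exactly `lu • shiftField` and
no chain rule for `f` is needed. The field is supported in the compact cube, so only the minimum of
`ε` there matters. -/
theorem exists_isPerturbation (hc : c.Admissible) {r : ℕ} (hr : 1 ≤ r) {f : Diff r}
    (hf : IsModel c f) {N : Set (Diff r)} (hN : IsCrNeighbourhood f N) :
    ∃ η : ℝ, 0 < η ∧ ∀ E : ℕ → ℝ, E 0 = 0 → E 1 = 0 →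
      (∀ k, |E k| * (c.lu ^ k) ^ r * 2 ^ k ≤ η) → ∃ g ∈ N, IsPerturbation c f g E := by
  obtain ⟨ε, hεc, hεpos, hεN⟩ := hN
  obtain ⟨H, hH⟩ := exists_isReturnBump hc
  obtain ⟨S, hS0, hS⟩ := hH.exists_bound hc r
  have hlu := hc.lu_pos
  obtain ⟨p0, -, hp0⟩ := isCompact_cube.exists_isMinOn (f := ε)
    ⟨0, by simp [cube, Prod.zero_eq_mk]⟩ hεc.continuousOn
  have hmin : ∀ p ∈ cube, ε p0 ≤ ε p := fun p hp => hp0 hp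
  have he0 := hεpos p0
  -- The first bound keeps moved points in the slab, the second makes `id + shiftField` a
  -- diffeomorphism, the third gives closeness to `f`.
  refine ⟨min (1 / 4) (min (1 / (4 * S)) (ε p0 / (4 * S * c.lu))), by positivity,
    fun E hE0 hE1 hE => ?_⟩
  set η := min (1 / 4) (min (1 / (4 * S)) (ε p0 / (4 * S * c.lu))) with hη
  have hη1 : η ≤ 1 / 4 := min_le_left _ _
  have hη2 : 2 * S * η ≤ 1 / 2 := by
    have : η ≤ 1 / (4 * S) := (min_le_right _ _).trans (min_le_left _ _)
    calc 2 * S * η ≤ 2 * S * (1 / (4 * S)) := by gcongr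
      _ = 1 / 2 := by field_simp; norm_num
  have hη3 : c.lu * (2 * S * η) < ε p0 := by
    have : η ≤ ε p0 / (4 * S * c.lu) := (min_le_right _ _).trans (min_le_right _ _)
    calc c.lu * (2 * S * η) ≤ c.lu * (2 * S * (ε p0 / (4 * S * c.lu))) := by gcongr
      _ = ε p0 / 2 := by field_simp; norm_num
      _ < _ := by linarith
  have hE' : ∀ k, |E k| * c.lu ^ k ≤ 1 / 4 := by
    intro k
    have h1 : 1 ≤ c.lu ^ k := one_le_pow₀ hc.one_lt_lu.le
    have h2 : (1 : ℝ) ≤ 2 ^ k := one_le_pow₀ (by norm_num)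
    calc |E k| * c.lu ^ k ≤ |E k| * (c.lu ^ k) ^ r := by
          gcongr; exact le_self_pow₀ h1 (by omega)
      _ ≤ |E k| * (c.lu ^ k) ^ r * 2 ^ k := le_mul_of_one_le_right (by positivity) h2
      _ ≤ 1 / 4 := (hE k).trans hη1
  obtain ⟨hcd, hsmall⟩ := hH.displacement_small hS0 hS hE
  have hfield : ContDiff ℝ r (shiftField c H E) :=
    (ContinuousLinearMap.inl ℝ ℝ (ℝ × ℝ)).contDiff.comp hcd
  have hle : ∀ i ≤ r, ((i : ℕ) : WithTop ℕ∞) ≤ ((r : ℕ) : WithTop ℕ∞) := fun i hi => by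
    exact_mod_cast hi
  have hfsmall : ∀ i ≤ r, ∀ p, ‖iteratedFDeriv ℝ i (shiftField c H E) p‖ ≤ 2 * S * η :=
    fun i hi p => (norm_iteratedFDeriv_inl_comp_le (hcd.of_le (hle i hi)) p).trans (hsmall i hi p)
  obtain ⟨Φ, hΦ⟩ := exists_diff_of_norm_fderiv_le hr hfield fun p => by
    have := hfsmall 1 hr p
    rw [norm_iteratedFDeriv_one] at this
    exact this.trans hη2
  have hgval : ∀ p, (Φ.trans f) p = f (p + shiftField c H E p) := fun p => by
    rw [← hΦ]; rfl
  have hfield_mk : ∀ x y z, (x, y, z) + shiftField c H E (x, y, z)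
      = (x + displacement c H E (x, y, z), y, z) := fun x y z => by simp [shiftField]
  have hsub : ∀ p, (Φ.trans f) p = f p + c.lu • shiftField c H E p := by
    rintro ⟨x, y, z⟩
    rw [hgval, hfield_mk]
    by_cases h0 : displacement c H E (x, y, z) = 0
    · simp [shiftField, h0]
    · obtain ⟨-, h1, h2, -⟩ := hH.mem_V0_of_displacement_ne_zero hc hE0 hE1 hE' h0
      rw [hf.on_V0 _ _ _ h1, hf.on_V0 _ _ _ h2]
      simp [shiftField, mul_add]
  have hfix : ∀ x y z, displacement c H E (x, y, z) = 0 → (Φ.trans f) (x, y, z) = f (x, y, z) := by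
    intro x y z h
    rw [hgval, hfield_mk, h, add_zero]
  refine ⟨Φ.trans f, hεN ?_, ?_, ?_, ?_, ?_⟩
  · intro i hi p
    have e : (fun q : E3 => (Φ.trans f) q) = (fun q => f q) + c.lu • shiftField c H E :=
      funext hsub
    have hfi : ContDiff ℝ i (fun q : E3 => f q) := (diff_contDiff f).of_le (hle i hi)
    have hfi' : ContDiff ℝ i (shiftField c H E) := hfield.of_le (hle i hi)
    have hfi2 : ContDiff ℝ i (c.lu • shiftField c H E) := hfi'.const_smul c.lu
    rw [e, iteratedFDeriv_add_apply hfi.contDiffAt hfi2.contDiffAt,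
      add_sub_cancel_left, iteratedFDeriv_const_smul_apply hfi'.contDiffAt, norm_smul,
      Real.norm_of_nonneg hlu.le]
    by_cases hp : p ∈ cube
    · exact (mul_le_mul_of_nonneg_left (hfsmall i hi p) hlu.le).trans_lt
        (hη3.trans_le (hmin p hp))
    · have hts : tsupport (shiftField c H E) ⊆ cube := by
        refine closure_minimal ?_ isCompact_cube.isClosed
        rintro ⟨x, y, z⟩ hq
        refine V0_subset_cube hc (hH.mem_V0_of_displacement_ne_zero hc hE0 hE1 hE' ?_).2.1
        intro h0
        exact hq (by simp [shiftField, h0])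
      have hz : iteratedFDeriv ℝ i (shiftField c H E) p = 0 := by
        by_contra h
        exact hp (hts (support_iteratedFDeriv_subset i h))
      rw [hz, norm_zero, mul_zero]
      exact hεpos p
  · rintro ⟨x, y, z⟩ hp
    refine hfix _ _ _ ?_
    by_contra h0
    exact hp (hH.mem_V0_of_displacement_ne_zero hc hE0 hE1 hE' h0).2.1
  · intro x y z hy
    refine hfix _ _ _ ?_
    by_contra h0
    exact hy (hH.mem_V0_of_displacement_ne_zero hc hE0 hE1 hE' h0).2.2.2
  · intro y z
    refine hfix _ _ _ ?_
    by_contra h0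
    exact lt_irrefl _ (hH.mem_V0_of_displacement_ne_zero hc hE0 hE1 hE' h0).1
  · intro k x y z hx hy hz
    have h1 : H (scale c k (x, y, z)) = 1 := by
      rw [scale_apply]; exact hH.one _ _ _ hx hy hz
    rw [hgval, hfield_mk, hH.displacement_eq hc (k := k) (by rw [h1]; norm_num), h1, mul_one]

/-! ### The itineraries of the wandering domains -/

/-- The word `0 b` repeated `n` times. -/
def block (b : Bool) (n : ℕ) : List Bool := (List.replicate n [false, b]).flatten

/-- The first part of the `k`-th itinerary: `0 ^ k 1 (0 b) ^ (k ^ 3)`. -/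
def prefixWord (b : Bool) (k : ℕ) : List Bool :=
  List.replicate k false ++ true :: block b (k ^ 3)

/-- The length of the `k`-th itinerary. -/
def wordLength (k : ℕ) : ℕ := 2 * k ^ 3 + k ^ 2 + k + 1

lemma block_succ (b : Bool) (n : ℕ) : block b (n + 1) = [false, b] ++ block b n := by
  simp [block, List.replicate_succ]

lemma length_block (b : Bool) (n : ℕ) : (block b n).length = 2 * n := by
  simp [block, mul_comm]

lemma length_prefixWord (b : Bool) (k : ℕ) : (prefixWord b k).length = 2 * k ^ 3 + k + 1 := by
  simp [prefixWord, length_block]; ring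

/-- The pair `01` contracts by exactly `lcs0 * lcs1`, and `00` contracts at least as much since
`lcs0 ≤ lcs1`. Both choices of letter thus obey the same estimate. -/
lemma rateZ_block_le (hc : c.Admissible) (b : Bool) (n : ℕ) :
    rateZ c (block b n) ≤ (c.lcs0 * c.lcs1) ^ n := by
  have h0 := hc.lcs0_pos
  have h1 := hc.lcs1_pos
  have h01 : c.lcs0 ≤ c.lcs1 := by linarith [hc.lcs0_lt, hc.lt_lcs1]
  induction n with
  | zero => simp [block, rateZ]
  | succ n ih =>
    rw [block_succ, rateZ_append, pow_succ, mul_comm]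
    refine mul_le_mul ih ?_ (rateZ_pos hc _).le (by positivity)
    cases b
    · simpa [rateZ, mul_comm c.lcs0 c.lcs1] using mul_le_mul_of_nonneg_right h01 h0.le
    · simp [rateZ, mul_comm]

lemma codeX_replicate (k : ℕ) (u : List Bool) (s : ℝ) :
    codeX c (List.replicate k false ++ u) s = codeX c u s / c.lu ^ k := by
  induction k with
  | zero => simp
  | succ k ih => simp [List.replicate_succ, codeX, ih, pow_succ, div_div]

lemma mul_codeX_prefixWord (hc : c.Admissible) (b : Bool) (k : ℕ) {s : ℝ}
    (hs : s ∈ Icc (0 : ℝ) 1) : c.lu ^ k * codeX c (prefixWord b k) s ∈ Icc (1 - c.lu⁻¹) 1 := by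
  have h := codeX_mem hc (block b (k ^ 3)) hs
  have hk : c.lu ^ k ≠ 0 := (pow_pos hc.lu_pos k).ne'
  rw [prefixWord, codeX_replicate, mul_div_cancel₀ _ hk]
  simp only [codeX, if_true]
  have h0 := div_nonneg h.1 hc.lu_pos.le
  have h1 : codeX c (block b (k ^ 3)) s / c.lu ≤ c.lu⁻¹ := by
    rw [div_eq_mul_inv]; exact mul_le_of_le_one_left hc.inv_pos.le h.2
  constructor <;> linarith

lemma half_mem : (1 / 2 : ℝ) ∈ Icc (0 : ℝ) 1 := ⟨by norm_num, by norm_num⟩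

/-- The height at which the `k`-th domain should be, truncated to the unit interval. -/
noncomputable def target (c : Params) (b : Bool) (k : ℕ) : ℝ :=
  min 1 (codeX c (prefixWord b k) (1 / 2) / c.a2)

lemma target_mem (hc : c.Admissible) (b : Bool) (k : ℕ) : target c b k ∈ Icc (0 : ℝ) 1 :=
  ⟨le_min zero_le_one (div_nonneg (codeX_mem hc _ half_mem).1 hc.a2_pos.le), min_le_left _ _⟩

/-- The words `v k`, of length `k ^ 2`, steer to the targets given by the letters `b`. -/
def IsSteering (c : Params) (b : ℕ → Bool) (v : ℕ → List Bool) : Prop :=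
  ∀ k, (v k).length = k ^ 2 ∧
    ∀ s ∈ Icc (0 : ℝ) 1, |codeZ c (v k) s - target c (b (k + 1)) (k + 1)| ≤ c.lcs1 ^ k ^ 2

/-- For every sequence of letters there are words of length `k ^ 2` steering to the next target. -/
lemma exists_isSteering (hc : c.Admissible) (b : ℕ → Bool) : ∃ v, IsSteering c b v := by
  choose v hv using fun k => exists_codeZ_close hc (k ^ 2) (target_mem hc (b (k + 1)) (k + 1))
  exact ⟨v, hv⟩

/-- The `k`-th itinerary. -/
def word (b : ℕ → Bool) (v : ℕ → List Bool) (k : ℕ) : List Bool := prefixWord (b k) k ++ v k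

/-- The height of the `k`-th domain. -/
noncomputable def height (c : Params) (b : ℕ → Bool) (v : ℕ → List Bool) : ℕ → ℝ
  | 0 => 1 / 2
  | k + 1 => codeZ c (word b v k) (1 / 2)

/-- The displacement needed at the `k`-th return. -/
noncomputable def offset (c : Params) (b : ℕ → Bool) (v : ℕ → List Bool) (k : ℕ) : ℝ :=
  codeX c (word b v k) (1 / 2) - c.a2 * height c b v k

section

variable {b : ℕ → Bool} {v : ℕ → List Bool}

lemma IsSteering.length_word (hv : IsSteering c b v) (k : ℕ) :
    (word b v k).length = wordLength k := by
  rw [word, List.length_append, length_prefixWord, (hv k).1, wordLength]; ring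

lemma mul_codeX_word (hc : c.Admissible) (k : ℕ) {s : ℝ}
    (hs : s ∈ Icc (0 : ℝ) 1) : c.lu ^ k * codeX c (word b v k) s ∈ Icc (1 - c.lu⁻¹) 1 := by
  rw [word, codeX_append]
  exact mul_codeX_prefixWord hc _ _ (codeX_mem hc _ hs)

lemma rateZ_word_le (hc : c.Admissible) (k : ℕ) :
    rateZ c (word b v k) ≤ (c.lcs0 * c.lcs1) ^ k ^ 3 := by
  have h1 : rateZ c (true :: block (b k) (k ^ 3)) ≤ rateZ c (block (b k) (k ^ 3)) := by
    simp only [rateZ, if_true]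
    exact mul_le_of_le_one_right (rateZ_pos hc _).le hc.lcs1_lt.le
  rw [word, prefixWord, rateZ_append, rateZ_append]
  calc _ ≤ 1 * rateZ c (true :: block (b k) (k ^ 3)) * 1 := by
        gcongr
        · exact (rateZ_pos hc _).le
        · have := rateZ_pos hc (true :: block (b k) (k ^ 3)); positivity
        · exact (rateZ_pos hc _).le
        · exact rateZ_le_one hc _
        · exact rateZ_le_one hc _
    _ ≤ _ := by
        rw [one_mul, mul_one]; exact h1.trans (rateZ_block_le hc _ _)

lemma eventually_le_mul_pow {a l M : ℝ} (ha : 0 < a) (hl : 1 < l) :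
    ∀ᶠ k : ℕ in atTop, M ≤ a * l ^ k :=
  ((tendsto_pow_atTop_atTop_of_one_lt hl).const_mul_atTop ha).eventually_ge_atTop M

/-- Two errors add up: the target was computed from the prefix alone, and the height misses the
target by the steering error. The first is at most `lu⁻¹` to the length of the prefix, hence far
smaller. The truncation in `target` is inactive for large `k`. -/
lemma IsSteering.abs_offset_le (hc : c.Admissible) (hv : IsSteering c b v) :
    ∀ᶠ k : ℕ in atTop, |offset c b v (k + 1)| ≤ (1 + c.a2) * c.lcs1 ^ k ^ 2 := by
  filter_upwards [eventually_le_mul_pow (M := 1) hc.a2_pos hc.one_lt_lu] with k hk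
  set X := codeX c (prefixWord (b (k + 1)) (k + 1)) (1 / 2) with hX
  have hlu := hc.lu_pos
  have ha2 := hc.a2_pos
  have hXle : X / c.a2 ≤ 1 := by
    have h1 := (mul_codeX_prefixWord hc (b (k + 1)) (k + 1) half_mem).2
    have h2 : 1 ≤ c.lu ^ (k + 1) * c.a2 := by
      calc 1 ≤ c.a2 * c.lu ^ k := hk
        _ ≤ c.a2 * c.lu ^ (k + 1) := by
            gcongr
            · exact hc.one_lt_lu.le
            · omega
        _ = _ := mul_comm _ _
    rw [div_le_one ha2]
    have := h1.trans h2
    exact le_of_mul_le_mul_left this (by positivity)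
  have ht : c.a2 * target c (b (k + 1)) (k + 1) = X := by
    rw [target, min_eq_right hXle]; field_simp
  have e1 : |codeX c (word b v (k + 1)) (1 / 2) - X| ≤ c.lcs1 ^ k ^ 2 := by
    rw [word, codeX_append, hX, abs_codeX_sub hc, length_prefixWord]
    have hm := codeX_mem hc (v (k + 1)) half_mem
    have h1 : |codeX c (v (k + 1)) (1 / 2) - 1 / 2| ≤ 1 := by
      rw [abs_le]; constructor <;> linarith [hm.1, hm.2]
    have h2 : c.lu⁻¹ ≤ c.lcs1 := by linarith [hc.inv_lt, hc.lt_lcs1]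
    calc _ ≤ 1 / c.lu ^ (2 * (k + 1) ^ 3 + (k + 1) + 1) := by gcongr
      _ = c.lu⁻¹ ^ (2 * (k + 1) ^ 3 + (k + 1) + 1) := by rw [inv_pow, one_div]
      _ ≤ c.lcs1 ^ (2 * (k + 1) ^ 3 + (k + 1) + 1) := pow_le_pow_left₀ hc.inv_pos.le h2 _
      _ ≤ _ := pow_le_pow_of_le_one hc.lcs1_pos.le hc.lcs1_lt.le (by nlinarith [sq_nonneg k])
  have e2 : |c.a2 * height c b v (k + 1) - X| ≤ c.a2 * c.lcs1 ^ k ^ 2 := by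
    rw [← ht, ← mul_sub, abs_mul, abs_of_pos ha2, height, word, codeZ_append]
    exact mul_le_mul_of_nonneg_left ((hv k).2 _ (codeZ_mem hc _ half_mem)) ha2.le
  have e3 : offset c b v (k + 1) = (codeX c (word b v (k + 1)) (1 / 2) - X)
      - (c.a2 * height c b v (k + 1) - X) := by rw [offset]; ring
  rw [e3]
  rw [abs_le] at e1 e2 ⊢
  constructor <;> linarith [e1.1, e1.2, e2.1, e2.2]

/-- The quadratic exponent in `lcs1 ^ k ^ 2` beats every geometric factor `B ^ k`. This is why the
steering words have length `k ^ 2`. -/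
lemma IsSteering.offset_small (hc : c.Admissible) (hv : IsSteering c b v) (r : ℕ) {η : ℝ}
    (hη : 0 < η) :
    ∀ᶠ k : ℕ in atTop, |offset c b v k| * (c.lu ^ k) ^ r * 2 ^ k ≤ η := by
  set B : ℝ := c.lu ^ r * 2 with hB
  have hlu := hc.lu_pos
  have ha2 := hc.a2_pos
  have hB0 : 0 < B := by positivity
  have h1 : ∀ᶠ k : ℕ in atTop, B * c.lcs1 ^ k ≤ 1 / 2 := by
    have := (tendsto_pow_atTop_nhds_zero_of_lt_one hc.lcs1_pos.le hc.lcs1_lt).const_mul B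
    rw [mul_zero] at this
    exact this.eventually_le_const (by norm_num)
  have h2 : ∀ᶠ k : ℕ in atTop, (1 + c.a2) * B * (1 / 2) ^ k ≤ η := by
    have := (tendsto_pow_atTop_nhds_zero_of_lt_one (r := (1 / 2 : ℝ)) (by norm_num)
      (by norm_num)).const_mul ((1 + c.a2) * B)
    rw [mul_zero] at this
    exact this.eventually_le_const hη
  have h3 : ∀ᶠ k : ℕ in atTop,
      |offset c b v (k + 1)| * (c.lu ^ (k + 1)) ^ r * 2 ^ (k + 1) ≤ η := by
    filter_upwards [h1, h2, hv.abs_offset_le hc] with k h1 h2 h3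
    have hl1 := hc.lcs1_pos
    calc |offset c b v (k + 1)| * (c.lu ^ (k + 1)) ^ r * 2 ^ (k + 1)
        ≤ (1 + c.a2) * c.lcs1 ^ k ^ 2 * (c.lu ^ (k + 1)) ^ r * 2 ^ (k + 1) := by gcongr
      _ = (1 + c.a2) * B * (B * c.lcs1 ^ k) ^ k := by rw [hB]; ring
      _ ≤ (1 + c.a2) * B * (1 / 2) ^ k := by gcongr
      _ ≤ η := h2
  exact (eventually_atTop.1 h3).elim fun K hK =>
    eventually_atTop.2 ⟨K + 1, fun k hk => by
      obtain ⟨j, rfl⟩ := Nat.exists_eq_add_of_le' (by omega : 1 ≤ k)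
      exact hK j (by omega)⟩

end

/-! ### The sizes of the wandering domains -/

lemma eventually_mul_pow_sq_lt_pow_cube {τ B C : ℝ} (hτ : 1 < τ) (m : ℕ) :
    ∀ᶠ k : ℕ in atTop, C * B ^ (m * k ^ 2) < τ ^ k ^ 3 := by
  obtain ⟨i, hi⟩ := pow_unbounded_of_one_lt |C| hτ
  obtain ⟨j, hj⟩ := pow_unbounded_of_one_lt |B| hτ
  filter_upwards [eventually_ge_atTop (i + j * m + 1)] with k hk
  calc C * B ^ (m * k ^ 2) ≤ |C| * |B| ^ (m * k ^ 2) := by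
        rw [← abs_pow, ← abs_mul]; exact le_abs_self _
    _ ≤ |C| * (τ ^ j) ^ (m * k ^ 2) := by gcongr
    _ < τ ^ i * (τ ^ j) ^ (m * k ^ 2) := by gcongr
    _ = τ ^ (i + j * (m * k ^ 2)) := by rw [← pow_mul, ← pow_add]
    _ ≤ τ ^ k ^ 3 := by
        refine pow_le_pow_right₀ hτ.le ?_
        have h1 : 1 ≤ k := by omega
        calc i + j * (m * k ^ 2) ≤ i * k ^ 2 + j * m * k ^ 2 := by
              have := Nat.le_mul_of_pos_right i (pow_pos h1 2)
              linarith
          _ = (i + j * m) * k ^ 2 := by ring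
          _ ≤ k * k ^ 2 := Nat.mul_le_mul_right _ (by omega)
          _ = k ^ 3 := by ring

lemma wordLength_succ (k : ℕ) : wordLength (k + 1) = wordLength k + (6 * k ^ 2 + 8 * k + 4) := by
  unfold wordLength; ring

lemma wordLength_tendsto : Tendsto wordLength atTop atTop :=
  tendsto_atTop_mono (fun k => by unfold wordLength; simp only [id]; omega) tendsto_id

/-- The strict inequality `lcs0 * lcs1 * lu ^ 2 < 1` leaves room for a rate slightly larger than
`lu`. -/
lemma exists_gap_rate (hc : c.Admissible) :
    ∃ τ : ℝ, 1 < τ ∧ c.lcs0 * c.lcs1 * (c.lu * τ ^ 2) ^ 2 ≤ 1 := by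
  have h : Tendsto (fun τ : ℝ => c.lcs0 * c.lcs1 * (c.lu * τ ^ 2) ^ 2) (𝓝[>] 1)
      (𝓝 (c.lcs0 * c.lcs1 * (c.lu * 1 ^ 2) ^ 2)) := by
    refine (Continuous.tendsto ?_ 1).mono_left nhdsWithin_le_nhds
    fun_prop
  have h1 := h.eventually_le_const (u := 1) (by simpa using hc.dissipative)
  obtain ⟨τ, h2, h3⟩ := (h1.and self_mem_nhdsWithin).exists
  exact ⟨τ, h3, h2⟩

lemma Params.Admissible.a1_pos (hc : c.Admissible) : 0 < c.a1 :=
  (_root_.inv_pos.2 (by linarith [hc.inv_lt])).trans hc.lt_a1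

/-- The estimates at stage `k` for domains of width `ρ k` in the direction of `x` and of width
`ρ k ^ 2` in the direction of `z`. -/
structure GoodStage (c : Params) (b : ℕ → Bool) (v : ℕ → List Bool) (ρ : ℕ → ℝ) (k : ℕ) :
    Prop where
  quadratic : c.lu ^ wordLength k * ((c.a1 + c.a2) * ρ k ^ 2) < ρ (k + 1)
  fibre : c.a4 * ρ k * rateZ c (word b v k) < ρ (k + 1) ^ 2
  lt_delta : ρ k < c.δ
  lt_half : ρ (k + 1) < 1 / 2
  lt_quarter : c.a4 * ρ k ≤ 1 / 4
  return_region : c.lu ^ k * ((c.a1 + c.a2) * ρ k ^ 2) + c.lu ^ k * |offset c b v k| ≤ c.margin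
  two_le : 2 ≤ c.a2 * c.lu ^ k

/-- With `l = lu * τ` and `ρ k = l ^ (-n)`, the quadratic estimate reduces to `(a1 + a2) * l ^ d < τ
^ n`, where `d` is the increment of the word length. The fibre estimate follows because `rateZ` is
at most `(lu * τ ^ 2) ^ (-2 * k ^ 3)`. In both, a power of `τ` with exponent of order `k ^ 3`
absorbs powers of `l` with exponents of order `k ^ 2`. -/
theorem exists_goodStage (hc : c.Admissible) :
    ∃ ρ : ℕ → ℝ, (∀ k, 0 < ρ k) ∧ Tendsto ρ atTop (𝓝 0) ∧
      ∀ b v, IsSteering c b v → ∀ᶠ k in atTop, GoodStage c b v ρ k := by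
  obtain ⟨τ, hτ, hgap⟩ := exists_gap_rate hc
  have hlu := hc.lu_pos
  have ha1 := hc.a1_pos
  have ha2 := hc.a2_pos
  have ha4 := hc.a4_pos
  have hτ0 : 0 < τ := by linarith
  set l := c.lu * τ with hl
  have hl1 : 1 < l := one_lt_mul_of_lt_of_le hc.one_lt_lu hτ.le
  have hl0 : 0 < l := by positivity
  have hρ0 : Tendsto (fun k => (l ^ wordLength k)⁻¹) atTop (𝓝 0) :=
    tendsto_inv_atTop_zero.comp ((tendsto_pow_atTop_atTop_of_one_lt hl1).comp wordLength_tendsto)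
  refine ⟨fun k => (l ^ wordLength k)⁻¹, fun k => by positivity, hρ0, fun b v hv => ?_⟩
  have hρ1 : Tendsto (fun k => (l ^ wordLength (k + 1))⁻¹) atTop (𝓝 0) :=
    hρ0.comp (tendsto_add_atTop_nat 1)
  have hm := hc.margin_pos
  -- The largest exponent to absorb is `2 * d + e = 13 * k ^ 2 + 17 * k + 9`, which is below `40 * k
  -- ^ 2` for `k ≥ 1`.
  filter_upwards [eventually_mul_pow_sq_lt_pow_cube (B := l) (C := c.a1 + c.a2) hτ 40,
    eventually_mul_pow_sq_lt_pow_cube (B := l) (C := c.a4) hτ 40,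
    hρ0.eventually_lt_const hc.δ_pos, hρ1.eventually_lt_const (u := 1 / 2) (by norm_num),
    hρ0.eventually_le_const (u := 1 / 4 / c.a4) (by positivity),
    hρ1.eventually_le_const (u := c.margin / 2) (by positivity),
    hv.offset_small hc 1 (η := c.margin / 2) (by positivity),
    eventually_le_mul_pow (M := 2) hc.a2_pos hc.one_lt_lu, eventually_ge_atTop 1]
    with k h1 h2 h3 h4 h5 h6 h7 h8 hk
  set n := wordLength k with hndef
  set d := 6 * k ^ 2 + 8 * k + 4 with hd
  have hkk : k ≤ k ^ 2 := Nat.le_self_pow (by norm_num) k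
  have hτn : τ ^ k ^ 3 ≤ τ ^ n := pow_le_pow_right₀ hτ.le (by rw [hndef, wordLength]; omega)
  have hquad : c.lu ^ n * ((c.a1 + c.a2) * (l ^ n)⁻¹ ^ 2) < (l ^ wordLength (k + 1))⁻¹ := by
    rw [wordLength_succ, ← hndef, ← hd, lt_inv_comm₀ (by positivity) (by positivity)]
    have e : (c.lu ^ n * ((c.a1 + c.a2) * (l ^ n)⁻¹ ^ 2))⁻¹ = τ ^ n * l ^ n / (c.a1 + c.a2) := by
      rw [hl, mul_pow]; field_simp
    rw [e, lt_div_iff₀ (by positivity)]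
    have h9 : (c.a1 + c.a2) * l ^ d < τ ^ n := by
      refine lt_of_le_of_lt ?_ (h1.trans_le hτn)
      gcongr
      · exact hl1.le
      · omega
    calc l ^ (n + d) * (c.a1 + c.a2) = ((c.a1 + c.a2) * l ^ d) * l ^ n := by ring
      _ < τ ^ n * l ^ n := by gcongr
  refine ⟨hquad, ?_, h3, h4, ?_, ?_, h8⟩
  · have hR : rateZ c (word b v k) * (c.lu * τ ^ 2) ^ (2 * k ^ 3) ≤ 1 := by
      calc _ ≤ (c.lcs0 * c.lcs1) ^ k ^ 3 * (c.lu * τ ^ 2) ^ (2 * k ^ 3) := by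
            gcongr; exact rateZ_word_le hc k
        _ = (c.lcs0 * c.lcs1 * (c.lu * τ ^ 2) ^ 2) ^ k ^ 3 := by
            rw [pow_mul, ← mul_pow]
        _ ≤ 1 := pow_le_one₀ (by have := hc.lcs0_pos; have := hc.lcs1_pos; positivity) hgap
    set e := k ^ 2 + k + 1 with he
    have hne : n = 2 * k ^ 3 + e := by rw [hndef, wordLength]; omega
    have h9 : c.a4 * l ^ (2 * d + e) < τ ^ k ^ 3 := by
      refine lt_of_le_of_lt ?_ h2
      gcongr
      · exact hl1.le
      · omega
    have h10 : c.a4 * l ^ (n + 2 * d) < (c.lu * τ ^ 2) ^ (2 * k ^ 3) := by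
      calc c.a4 * l ^ (n + 2 * d) = c.a4 * l ^ (2 * d + e) * l ^ (2 * k ^ 3) := by
            rw [hne]; ring
        _ < τ ^ k ^ 3 * l ^ (2 * k ^ 3) := by gcongr
        _ ≤ τ ^ (2 * k ^ 3) * l ^ (2 * k ^ 3) := by
            gcongr
            · exact hτ.le
            · omega
        _ = _ := by rw [hl]; ring
    have hRpos := rateZ_pos hc (word b v k)
    have h11 : c.a4 * l ^ (n + 2 * d) * rateZ c (word b v k) < 1 := by
      calc _ < (c.lu * τ ^ 2) ^ (2 * k ^ 3) * rateZ c (word b v k) := by gcongr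
        _ ≤ 1 := by rw [mul_comm]; exact hR
    rw [wordLength_succ, ← hndef, ← hd, inv_pow, lt_inv_comm₀ (by positivity) (by positivity)]
    have e1 : (c.a4 * (l ^ n)⁻¹ * rateZ c (word b v k))⁻¹
        = l ^ n / (c.a4 * rateZ c (word b v k)) := by
      field_simp
    rw [e1, lt_div_iff₀ (by positivity)]
    calc (l ^ (n + d)) ^ 2 * (c.a4 * rateZ c (word b v k))
        = (c.a4 * l ^ (n + 2 * d) * rateZ c (word b v k)) * l ^ n := by ring
      _ < 1 * l ^ n := by gcongr
      _ = l ^ n := one_mul _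
  · rw [le_div_iff₀ ha4] at h5; linarith
  · have h12 : c.lu ^ k * ((c.a1 + c.a2) * (l ^ n)⁻¹ ^ 2) ≤ c.margin / 2 := by
      refine le_trans ?_ (hquad.le.trans h6)
      gcongr
      · exact hc.one_lt_lu.le
      · rw [hndef, wordLength]; omega
    have h13 : c.lu ^ k * |offset c b v k| ≤ c.margin / 2 := by
      refine le_trans ?_ h7
      rw [pow_one, mul_comm]
      exact le_mul_of_one_le_right (by positivity) (one_le_pow₀ (by norm_num))
    linarith

/-! ### The wandering domain of the perturbed map -/

/-- All the data of the construction: the model `f`, its perturbation `g`, and the itineraries and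
widths of the domains from stage `K` on. -/
structure Tower (c : Params) (f g : E3 → E3) (b : ℕ → Bool) (v : ℕ → List Bool) (ρ E : ℕ → ℝ)
    (K : ℕ) : Prop where
  adm : c.Admissible
  model : IsModel c f
  cont : Continuous f
  inj : Function.Injective g
  pert : IsPerturbation c f g E
  steering : IsSteering c b v
  pos : ∀ k, 0 < ρ k
  tendsto : Tendsto ρ atTop (𝓝 0)
  stage : ∀ k, K ≤ k → GoodStage c b v ρ k
  offset_eq : ∀ k, K ≤ k → E k = offset c b v k

/-- The `k`-th box of the construction. -/
def box (c : Params) (b : ℕ → Bool) (v : ℕ → List Bool) (ρ : ℕ → ℝ) (k : ℕ) : Set E3 :=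
  {p | |p.1 - 1 / 2| < ρ k ∧ p.2.1 ∈ Icc (0 : ℝ) 1 ∧ |p.2.2 - height c b v k| < ρ k ^ 2}

/-- The interior of the `k`-th box. -/
def domain (c : Params) (b : ℕ → Bool) (v : ℕ → List Bool) (ρ : ℕ → ℝ)
    (k : ℕ) : Set E3 :=
  Ioo (1 / 2 - ρ k) (1 / 2 + ρ k) ×ˢ
    (Ioo 0 1 ×ˢ Ioo (height c b v k - ρ k ^ 2) (height c b v k + ρ k ^ 2))

/-- The time at which the domain arrives in the box of index `K + m`. -/
def time (K : ℕ) : ℕ → ℕ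
  | 0 => 0
  | m + 1 => time K m + (wordLength (K + m) + 2)

lemma exists_time_add (K i : ℕ) : ∃ m j, i = time K m + j ∧ j < wordLength (K + m) + 2 := by
  induction i with
  | zero => exact ⟨0, 0, rfl, by omega⟩
  | succ i ih =>
    obtain ⟨m, j, h, hj⟩ := ih
    by_cases hlt : j + 1 < wordLength (K + m) + 2
    · exact ⟨m, j + 1, by omega, hlt⟩
    · exact ⟨m + 1, 0, by rw [time]; omega, by omega⟩

lemma time_strictMono (K : ℕ) : StrictMono (time K) :=
  strictMono_nat_of_lt_succ fun m => by rw [time]; omega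

lemma mk_mem_cube {x y z : ℝ} :
    (x, y, z) ∈ cube ↔ x ∈ Icc (0 : ℝ) 1 ∧ y ∈ Icc (0 : ℝ) 1 ∧ z ∈ Icc (0 : ℝ) 1 := Iff.rfl

lemma mem_gap_of_abs_sub_lt {c : Params} (hc : c.Admissible) {x y z : ℝ}
    (hx : |x - 1 / 2| < c.δ) (hy : y ∈ Icc (0 : ℝ) 1) (hz : z ∈ Icc (0 : ℝ) 1) :
    (x, y, z) ∈ gap c.lu := by
  have h := abs_lt.1 hx
  have hd := hc.δ_lt
  have hi := hc.inv_pos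
  refine ⟨mk_mem_cube.2 ⟨⟨by linarith, by linarith⟩, hy, hz⟩, ?_⟩
  rintro (h' | h')
  · linarith [h'.1.2]
  · linarith [h'.1.1]

lemma dist_mk_le {x y z x' y' z' r : ℝ} (hx : |x - x'| ≤ r) (hy : |y - y'| ≤ r)
    (hz : |z - z'| ≤ r) : dist ((x, y, z) : E3) (x', y', z') ≤ r := by
  rw [Prod.dist_eq, Prod.dist_eq]
  exact max_le hx (max_le hy hz)

/-- The orbit of `p` through stage `k`: it leaves the cube, and it comes back to follow the
itinerary of the stage, landing at `x`-coordinate `s`. -/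
structure FollowsWord (c : Params) (f g : E3 → E3) (w : List Bool) (e s : ℝ) (p : E3) :
    Prop where
  notMem : g p ∉ cube
  map_eq : g p = f p
  snd_mem : c.a3 * (p.2.1 - 1 / 2) + 1 / 2 ∈ Icc (0 : ℝ) 1
  trd_mem : c.a4 * (p.1 - 1 / 2) + 1 / 2 ∈ Icc (0 : ℝ) 1
  land_mem : s ∈ Icc (0 : ℝ) 1
  second : g^[2] p =
    (codeX c w s - e, c.a3 * (p.2.1 - 1 / 2) + 1 / 2, c.a4 * (p.1 - 1 / 2) + 1 / 2)
  later : ∀ j, 1 ≤ j → j ≤ w.length → g^[j + 2] p = f^[j]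
    (codeX c w s, c.a3 * (p.2.1 - 1 / 2) + 1 / 2, c.a4 * (p.1 - 1 / 2) + 1 / 2)

/-! ### One passage through a stage -/

namespace Tower

variable {c : Params} {f g : E3 → E3} {b : ℕ → Bool} {v : ℕ → List Bool} {ρ E : ℕ → ℝ} {K : ℕ}

lemma mem_box (h : Tower c f g b v ρ E K) {k : ℕ} (hk : K ≤ k) {x y z : ℝ}
    (hp : (x, y, z) ∈ box c b v ρ k) :
    z ∈ Icc (0 : ℝ) 1 ∧
    c.lu ^ k * (c.a2 * z) ∈ Icc (1 - c.lu⁻¹ - c.margin) (1 + c.margin) ∧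
    c.lu ^ k * (-c.a1 * (x - 1 / 2) ^ 2 + c.a2 * z) ∈
      Icc (1 - c.lu⁻¹ - c.margin) (1 + c.margin) ∧
    |-c.a1 * (x - 1 / 2) ^ 2 + c.a2 * z - c.a2 * height c b v k| ≤ (c.a1 + c.a2) * ρ k ^ 2 := by
  obtain ⟨hx, -, hz⟩ := hp
  simp only at hx hz
  have hc := h.adm
  have ha1 := hc.a1_pos
  have ha2 := hc.a2_pos
  have hl : 0 < c.lu ^ k := pow_pos hc.lu_pos k
  have hs := h.stage k hk
  have hreg := hs.return_region
  have hsq : (x - 1 / 2) ^ 2 ≤ ρ k ^ 2 := sq_le_sq' (abs_lt.1 hx).1.le (abs_lt.1 hx).2.le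
  have hsq0 := sq_nonneg (x - 1 / 2)
  have hz' := abs_lt.1 hz
  -- Here `θ` stands for `(x - 1 / 2) ^ 2`. The case `θ = 0` controls `a2 * z` alone, which locates
  -- `z` and later separates the boxes.
  have key : ∀ θ : ℝ, 0 ≤ θ → θ ≤ ρ k ^ 2 →
      |-c.a1 * θ + c.a2 * z - c.a2 * height c b v k| ≤ (c.a1 + c.a2) * ρ k ^ 2 := by
    intro θ h0 h1
    have e1 := mul_le_mul_of_nonneg_left h1 ha1.le
    have e2 := mul_nonneg ha1.le h0
    have e3 := mul_le_mul_of_nonneg_left hz'.1.le ha2.le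
    have e4 := mul_le_mul_of_nonneg_left hz'.2.le ha2.le
    have e5 : 0 ≤ c.a1 * ρ k ^ 2 := by positivity
    rw [abs_le]
    constructor <;> linarith
  have key2 : ∀ θ : ℝ, 0 ≤ θ → θ ≤ ρ k ^ 2 →
      c.lu ^ k * (-c.a1 * θ + c.a2 * z) ∈ Icc (1 - c.lu⁻¹ - c.margin) (1 + c.margin) := by
    intro θ h0 h1
    have e1 := abs_le.1 (key θ h0 h1)
    have e2 := mul_codeX_word (b := b) (v := v) hc k half_mem
    have e3 := mul_le_mul_of_nonneg_left e1.1 hl.le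
    have e4 := mul_le_mul_of_nonneg_left e1.2 hl.le
    have e5 : c.lu ^ k * (c.a2 * height c b v k) =
        c.lu ^ k * codeX c (word b v k) (1 / 2) - c.lu ^ k * offset c b v k := by
      rw [offset]; ring
    have e6 := abs_le.1 (le_refl |offset c b v k|)
    have e7 := mul_le_mul_of_nonneg_left e6.1 hl.le
    have e8 := mul_le_mul_of_nonneg_left e6.2 hl.le
    have e9 := e2.1
    have e10 := e2.2
    constructor <;> linarith
  have hmul : c.lu ^ k * (c.a2 * z) ∈ Icc (1 - c.lu⁻¹ - c.margin) (1 + c.margin) := by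
    simpa using key2 0 le_rfl (sq_nonneg _)
  refine ⟨⟨?_, ?_⟩, hmul, key2 _ hsq0 hsq, key _ hsq0 hsq⟩
  · have h1 : 0 < c.lu ^ k * (c.a2 * z) := by
      linarith [hmul.1, hc.inv_lt, hc.margin_le]
    exact (pos_of_mul_pos_right (pos_of_mul_pos_right h1 hl.le) ha2.le).le
  · have h1 : (c.a2 * c.lu ^ k) * z ≤ (c.a2 * c.lu ^ k) * 1 := by
      linarith [hmul.2, hc.margin_le, hs.two_le]
    exact le_of_mul_le_mul_left h1 (by positivity)

lemma box_subset_gap (h : Tower c f g b v ρ E K) {k : ℕ} (hk : K ≤ k) :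
    box c b v ρ k ⊆ gap c.lu := by
  rintro ⟨x, y, z⟩ hp
  exact mem_gap_of_abs_sub_lt h.adm (hp.1.trans (h.stage k hk).lt_delta) hp.2.1 (h.mem_box hk hp).1

/-- Neither the point nor its image lies in the first slab, so the perturbation is not felt during
the two steps of the tangency map. -/
lemma map_eq_of_mem_gap (h : Tower c f g b v ρ E K) {p : E3} (hp : p ∈ gap c.lu) :
    g p = f p ∧ f p ∉ cube ∧ g (g p) = f (f p) := by
  have h1 : g p = f p := h.pert.of_notMem p fun h' => hp.2 (Or.inl h')
  have h2 := h.model.on_gap p hp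
  exact ⟨h1, h2, by rw [h1, h.pert.of_notMem _ fun h' => h2 (V0_subset_cube h.adm h')]⟩

lemma mem_middle {y : ℝ} (hy : y ∈ Icc (0 : ℝ) 1) :
    c.a3 * (y - 1 / 2) + 1 / 2 ∈ Icc (1 / 2 - |c.a3| / 2) (1 / 2 + |c.a3| / 2) := by
  have h1 : |y - 1 / 2| ≤ 1 / 2 := by rw [abs_le]; constructor <;> linarith [hy.1, hy.2]
  have h2 : |c.a3 * (y - 1 / 2)| ≤ |c.a3| / 2 := by
    rw [abs_mul]
    have := mul_le_mul_of_nonneg_left h1 (abs_nonneg c.a3)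
    linarith
  have := abs_le.1 h2
  constructor <;> linarith

lemma middle_subset (hc : c.Admissible) :
    Icc (1 / 2 - |c.a3| / 2) (1 / 2 + |c.a3| / 2) ⊆ Icc (0 : ℝ) 1 := by
  have := hc.a3_lt
  have := hc.lss_pos
  exact Icc_subset_Icc (by linarith) (by linarith)

/-- Translation by `E k = offset c b v k` turns `a2 * height` into the starting point that lands at
`1 / 2`. What remains is the quadratic deviation, stretched by `lu ^ wordLength k`. -/
lemma exists_followsWord (h : Tower c f g b v ρ E K) {k : ℕ} (hk : K ≤ k) {p : E3}
    (hp : p ∈ box c b v ρ k) :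
    ∃ s, |s - 1 / 2| < ρ (k + 1) ∧ FollowsWord c f g (word b v k) (E k) s p := by
  obtain ⟨x, y, z⟩ := p
  have hc := h.adm
  have hs := h.stage k hk
  obtain ⟨hz, -, hreg, hdev⟩ := h.mem_box hk hp
  have hgap := h.box_subset_gap hk hp
  obtain ⟨hg1, hg2, hg3⟩ := h.map_eq_of_mem_gap hgap
  have hx : |x - 1 / 2| < ρ k := hp.1
  rw [h.model.tangency x y z hgap (hx.trans hs.lt_delta)] at hg3
  obtain ⟨s, hsx⟩ := codeX_surjective hc (word b v k)
    (-c.a1 * (x - 1 / 2) ^ 2 + c.a2 * z + E k)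
  have hy' : c.a3 * (y - 1 / 2) + 1 / 2 ∈ _ := mem_middle (c := c) hp.2.1
  have hz' : c.a4 * (x - 1 / 2) + 1 / 2 ∈ Icc (1 / 4 : ℝ) (3 / 4) := by
    have h1 : |c.a4 * (x - 1 / 2)| ≤ 1 / 4 := by
      rw [abs_mul, abs_of_pos hc.a4_pos]
      exact (mul_le_mul_of_nonneg_left hx.le hc.a4_pos.le).trans hs.lt_quarter
    have := abs_le.1 h1
    constructor <;> linarith
  have hland : |s - 1 / 2| < ρ (k + 1) := by
    have h1 := abs_codeX_sub hc (word b v k) s (1 / 2)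
    have hl : 0 < c.lu ^ wordLength k := pow_pos hc.lu_pos _
    rw [hsx, h.steering.length_word, eq_div_iff hl.ne'] at h1
    rw [← h1, mul_comm]
    refine lt_of_le_of_lt (mul_le_mul_of_nonneg_left ?_ hl.le) hs.quadratic
    have e : -c.a1 * (x - 1 / 2) ^ 2 + c.a2 * z + E k - codeX c (word b v k) (1 / 2)
        = -c.a1 * (x - 1 / 2) ^ 2 + c.a2 * z - c.a2 * height c b v k := by
      rw [h.offset_eq k hk, offset]; ring
    rw [e]; exact hdev
  have hsm : s ∈ Icc (0 : ℝ) 1 := by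
    have := abs_lt.1 (hland.trans hs.lt_half)
    constructor <;> linarith
  have hyI := middle_subset hc hy'
  have hzI : c.a4 * (x - 1 / 2) + 1 / 2 ∈ Icc (0 : ℝ) 1 :=
    ⟨by linarith [hz'.1], by linarith [hz'.2]⟩
  refine ⟨s, hland, hg1 ▸ hg2, hg1, hyI, hzI, hsm, ?_, ?_⟩
  · rw [hsx, add_sub_cancel_right]; exact hg3
  · intro j hj hjn
    induction j, hj using Nat.le_induction with
    | base =>
      change g (g (g (x, y, z))) = _
      -- The third application of `g` is the only one affected by the translation.
      rw [hg3, h.pert.shift k _ _ _ hreg hy' hz', ← hsx]; rfl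
    | succ j hj ih =>
      rw [show j + 1 + 2 = (j + 2) + 1 by ring, Function.iterate_succ_apply' g,
        Function.iterate_succ_apply' f, ih (by omega),
        h.model.iterate_code_take hc _ (by omega) hsm hyI hzI]
      -- After at least one letter, `y` has left the strip in which the perturbation acts.
      refine h.pert.of_edge _ _ _ (codeY_not_mem_middle hc ?_ hyI)
      intro h0
      have := congrArg List.length h0
      simp at this
      rcases this with h | h
      · omega
      · simp [h] at hjn

end Tower

lemma FollowsWord.later_eq {c : Params} {f g : E3 → E3} {w : List Bool} {e s : ℝ} {p : E3}
    (h : FollowsWord c f g w e s p) (hc : c.Admissible) (hf : IsModel c f) {j : ℕ} (hj : 1 ≤ j)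
    (hjw : j ≤ w.length) :
    g^[j + 2] p = (codeX c (w.drop j) s, codeY c (w.take j) (c.a3 * (p.2.1 - 1 / 2) + 1 / 2),
      codeZ c (w.take j) (c.a4 * (p.1 - 1 / 2) + 1 / 2)) := by
  rw [h.later j hj hjw, hf.iterate_code_take hc w hjw h.land_mem h.snd_mem h.trd_mem]

/-! ### From box to box, and the wandering property -/

namespace Tower

variable {c : Params} {f g : E3 → E3} {b : ℕ → Bool} {v : ℕ → List Bool} {ρ E : ℕ → ℝ} {K : ℕ}

lemma iterate_wordLength (h : Tower c f g b v ρ E K) {k : ℕ} {s : ℝ} {p : E3}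
    (hp : FollowsWord c f g (word b v k) (E k) s p) :
    g^[wordLength k + 2] p = (s, codeY c (word b v k) (c.a3 * (p.2.1 - 1 / 2) + 1 / 2),
      codeZ c (word b v k) (c.a4 * (p.1 - 1 / 2) + 1 / 2)) := by
  have hl := h.steering.length_word k
  have := hp.later_eq h.adm h.model (j := wordLength k) (by unfold wordLength; omega) hl.ge
  rw [this, List.drop_of_length_le hl.le, List.take_of_length_le hl.le]; rfl

lemma iterate_mem_box_succ (h : Tower c f g b v ρ E K) {k : ℕ} (hk : K ≤ k) {p : E3}
    (hp : p ∈ box c b v ρ k) : g^[wordLength k + 2] p ∈ box c b v ρ (k + 1) := by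
  obtain ⟨s, hs, hw⟩ := h.exists_followsWord hk hp
  rw [h.iterate_wordLength hw]
  refine ⟨hs, codeY_mem h.adm _ hw.snd_mem, ?_⟩
  simp only [height]
  rw [abs_codeZ_sub h.adm, add_sub_cancel_right, abs_mul, abs_of_pos h.adm.a4_pos]
  refine lt_of_le_of_lt ?_ (h.stage k hk).fibre
  rw [mul_comm]
  have := h.adm.a4_pos
  have := (rateZ_pos h.adm (word b v k)).le
  gcongr
  exact hp.1.le

lemma iterate_time_mem_box (h : Tower c f g b v ρ E K) {p : E3} (hp : p ∈ box c b v ρ K) (m : ℕ) :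
    g^[time K m] p ∈ box c b v ρ (K + m) := by
  induction m with
  | zero => exact hp
  | succ m ih =>
    rw [time, add_comm (time K m), Function.iterate_add_apply]
    exact h.iterate_mem_box_succ (Nat.le_add_right K m) ih

lemma iterate_mem_cube (h : Tower c f g b v ρ E K) {k : ℕ} {s : ℝ} {p : E3}
    (hp : FollowsWord c f g (word b v k) (E k) s p) {j : ℕ} (hj : 1 ≤ j)
    (hjw : j ≤ wordLength k) : g^[j + 2] p ∈ cube := by
  rw [hp.later_eq h.adm h.model hj (by rwa [h.steering.length_word])]
  exact mk_mem_cube.2 ⟨codeX_mem h.adm _ hp.land_mem, codeY_mem h.adm _ hp.snd_mem,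
    codeZ_mem h.adm _ hp.trd_mem⟩

/-- A point of any box lies in the cube and leaves it at the next step. The first iterate is outside
the cube, and each later one within the stage has its successor inside. -/
lemma not_mem_box_of_lt (h : Tower c f g b v ρ E K) {k : ℕ} (hk : K ≤ k) {p : E3}
    (hp : p ∈ box c b v ρ k) {l : ℕ} (hl : K ≤ l) {j : ℕ} (hj : 1 ≤ j)
    (hjw : j < wordLength k + 2) : g^[j] p ∉ box c b v ρ l := by
  obtain ⟨s, -, hw⟩ := h.exists_followsWord hk hp
  intro hmem
  obtain ⟨i, rfl⟩ := Nat.exists_eq_add_of_le' hj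
  have hgap := h.box_subset_gap hl hmem
  rcases Nat.eq_zero_or_pos i with rfl | hi
  · exact hw.notMem hgap.1
  · obtain ⟨h1, h2, -⟩ := h.map_eq_of_mem_gap hgap
    rw [← h1, ← Function.iterate_succ_apply' g] at h2
    exact h2 (h.iterate_mem_cube hw hi (by omega))

/-- At arrival times the boxes are separated by the scale of `a2 * z`, through `scale_disjoint`; at
the other times the previous lemma applies. -/
lemma not_mem_box_of_pos (h : Tower c f g b v ρ E K) {p : E3} (hp : p ∈ box c b v ρ K) {i : ℕ}
    (hi : 0 < i) : g^[i] p ∉ box c b v ρ K := by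
  obtain ⟨m, j, rfl, hj⟩ := exists_time_add K i
  have hm := h.iterate_time_mem_box hp m
  rcases Nat.eq_zero_or_pos j with rfl | hj0
  · have hm0 : m ≠ 0 := by rintro rfl; simp [time] at hi
    intro hmem
    rw [add_zero] at hmem
    have h1 := (h.mem_box (by omega) hm).2.1
    have h2 := (h.mem_box le_rfl hmem).2.1
    have hmp := h.adm.margin_pos
    exact scale_disjoint h.adm (show K < K + m by omega) (h1.2.trans_lt (by linarith))
      (lt_of_lt_of_le (by linarith) h2.1)
  · rw [add_comm, Function.iterate_add_apply]
    exact h.not_mem_box_of_lt (by omega) hm le_rfl hj0 hj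

lemma domain_subset_box (k : ℕ) : domain c b v ρ k ⊆ box c b v ρ k := by
  rintro ⟨x, y, z⟩ ⟨hx, hy, hz⟩
  simp only [mem_Ioo] at hx hz
  refine ⟨abs_lt.2 ⟨?_, ?_⟩, Ioo_subset_Icc_self hy, abs_lt.2 ⟨?_, ?_⟩⟩ <;> simp only <;> linarith

/-- A limit point of the orbit is not periodic. -/
lemma exists_mem_omegaSet (h : Tower c f g b v ρ E K) {p : E3} (hp : p ∈ box c b v ρ K) :
    ∃ q ∈ omegaSet g p, q ∉ Function.periodicPts g := by
  have hc := h.adm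
  have hmem := fun m => h.iterate_time_mem_box hp m
  have hcube : ∀ m, g^[time K m] p ∈ cube := fun m => (h.box_subset_gap (by omega) (hmem m)).1
  obtain ⟨q, -, φ, hφ, hlim⟩ := isCompact_cube.tendsto_subseq hcube
  have hKφ : Tendsto (fun i => K + φ i) atTop atTop :=
    tendsto_atTop_mono (fun i => by omega) hφ.tendsto_atTop
  have hρ : Tendsto (fun i => ρ (K + φ i)) atTop (𝓝 0) := h.tendsto.comp hKφ
  have hx : q.1 = 1 / 2 := by
    have h1 : Tendsto (fun i => (g^[time K (φ i)] p).1) atTop (𝓝 q.1) := hlim.fst_nhds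
    have h2 : Tendsto (fun i => (g^[time K (φ i)] p).1 - 1 / 2) atTop (𝓝 0) :=
      squeeze_zero_norm (fun i => (hmem (φ i)).1.le) hρ
    have := tendsto_nhds_unique (h1.sub_const (1 / 2)) h2
    linarith
  have hy : q.2.1 ∈ Icc (0 : ℝ) 1 :=
    isClosed_Icc.mem_of_tendsto hlim.snd_nhds.fst_nhds (.of_forall fun i => (hmem (φ i)).2.1)
  have hz : q.2.2 = 0 := by
    have h1 : Tendsto (fun i => (g^[time K (φ i)] p).2.2) atTop (𝓝 q.2.2) :=
      hlim.snd_nhds.snd_nhds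
    have h2 : Tendsto (fun i => 2 / c.a2 * (c.lu ^ (K + φ i))⁻¹) atTop (𝓝 0) := by
      have := (tendsto_inv_atTop_zero.comp
        ((tendsto_pow_atTop_atTop_of_one_lt hc.one_lt_lu).comp hKφ)).const_mul (2 / c.a2)
      simpa using this
    refine tendsto_nhds_unique h1 (squeeze_zero_norm (fun i => ?_) h2)
    obtain ⟨h3, h4, -⟩ := h.mem_box (by omega) (hmem (φ i))
    have hl : 0 < c.lu ^ (K + φ i) := pow_pos hc.lu_pos _
    have ha2 := hc.a2_pos
    rw [Real.norm_of_nonneg h3.1, ← div_eq_mul_inv, div_div, le_div_iff₀ (by positivity)]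
    have := h4.2
    have := hc.margin_le
    linarith
  obtain ⟨x, y, z⟩ := q
  simp only at hx hy hz
  subst hx hz
  refine ⟨_, mem_omegaLimit_singleton_iff_mapClusterPt .. |>.2
    (MapClusterPt.of_comp ((time_strictMono K).tendsto_atTop.comp hφ.tendsto_atTop)
      hlim.mapClusterPt), ?_⟩
  have hd : |(1 / 2 : ℝ) - 1 / 2| < c.δ := by simpa using hc.δ_pos
  have hgap := mem_gap_of_abs_sub_lt hc hd hy (left_mem_Icc.2 zero_le_one)
  obtain ⟨-, -, hg⟩ := h.map_eq_of_mem_gap hgap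
  rw [h.model.tangency _ _ _ hgap hd] at hg
  -- The limit point `(1 / 2, y, 0)` reaches the plane `x = 0` in two steps and stays in it, hence
  -- never returns to `x = 1 / 2`.
  have hzero : ∀ i, ∃ y' ∈ Icc (0 : ℝ) 1, ∃ z' ∈ Icc (0 : ℝ) 1,
      g^[i + 2] ((1 / 2, y, 0) : E3) = (0, y', z') := by
    intro i
    induction i with
    | zero =>
      refine ⟨_, middle_subset hc (mem_middle hy), 1 / 2, half_mem, ?_⟩
      change g (g _) = _
      rw [hg]; simp
    | succ i ih =>
      obtain ⟨y', hy', z', hz', e⟩ := ih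
      have hV : ((0, y', z') : E3) ∈ V0 c.lu :=
        ⟨left_mem_Icc.2 hc.inv_pos.le, hy', hz'⟩
      refine ⟨_, codeY_mem hc [false] hy', _, codeZ_mem hc [false] hz', ?_⟩
      rw [show i + 1 + 2 = (i + 2) + 1 by ring, Function.iterate_succ_apply', e,
        h.pert.of_zero, h.model.on_V0 _ _ _ hV]
      simp [codeY, codeZ]
  rintro ⟨n, hn, hper⟩
  -- Twice the period is used so that the time is at least two, even for a fixed point.
  obtain ⟨y', -, z', -, e⟩ := hzero (2 * n - 2)
  have h2 : g^[2 * n] ((1 / 2, y, 0) : E3) = (1 / 2, y, 0) := by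
    rw [mul_comm]; exact hper.mul_const 2
  rw [show 2 * n - 2 + 2 = 2 * n by omega, h2] at e
  have := congrArg Prod.fst e
  norm_num at this

theorem isWanderingDomain (h : Tower c f g b v ρ E K) :
    IsWanderingDomain g (domain c b v ρ K) where
  isOpen := isOpen_Ioo.prod (isOpen_Ioo.prod isOpen_Ioo)
  isConnected := by
    have := h.pos K
    have : 0 < ρ K ^ 2 := by positivity
    exact (isConnected_Ioo (by linarith)).prod
      ((isConnected_Ioo one_pos).prod (isConnected_Ioo (by linarith)))
  disjoint := by
    have key : ∀ i j : ℕ, i < j →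
        Disjoint (g^[i] '' domain c b v ρ K) (g^[j] '' domain c b v ρ K) := by
      intro i j hij
      rw [Set.disjoint_left]
      rintro _ ⟨p, hp, rfl⟩ ⟨q, hq, hpq⟩
      rw [show j = i + (j - i) by omega, Function.iterate_add_apply] at hpq
      have := h.inj.iterate i hpq
      exact h.not_mem_box_of_pos (domain_subset_box _ hq) (i := j - i) (by omega)
        (this ▸ domain_subset_box _ hp)
    intro i j hij
    rcases hij.lt_or_gt with hlt | hlt
    · exact key i j hlt
    · exact (key j i hlt).symm
  nontrivial := by
    intro p hp heq
    have hpos := h.pos K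
    have hpos2 : 0 < ρ K ^ 2 := by positivity
    have hx : ((1 / 2, 1 / 2, height c b v K) : E3) ∈ domain c b v ρ K :=
      ⟨⟨by simp only; linarith, by simp only; linarith⟩, ⟨by norm_num, by norm_num⟩,
        ⟨by simp only; linarith, by simp only; linarith⟩⟩
    obtain ⟨q, hq, hper⟩ := h.exists_mem_omegaSet (domain_subset_box _ hx)
    have : q ∈ forwardOrbit g p := heq ▸ mem_biUnion hx hq
    obtain ⟨i, rfl⟩ := this
    obtain ⟨n, hn, hn'⟩ := hp
    exact hper ⟨n, hn, hn'.apply_iterate i⟩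

end Tower

namespace Tower

variable {c : Params} {f g : E3 → E3} {b : ℕ → Bool} {v : ℕ → List Bool} {ρ E : ℕ → ℝ} {K : ℕ}

/-! ### Contraction -/

/-- The boxes have full width in `y`; smallness in that direction is inherited from the preceding
stage. -/
lemma abs_sub_snd_le (h : Tower c f g b v ρ E K) {k : ℕ} (hk : K ≤ k) {p q : E3}
    (hp : p ∈ box c b v ρ k) (hq : q ∈ box c b v ρ k) :
    |(g^[wordLength k + 2] p).2.1 - (g^[wordLength k + 2] q).2.1| ≤ c.lss ^ wordLength k := by
  obtain ⟨s, -, hs⟩ := h.exists_followsWord hk hp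
  obtain ⟨t, -, ht⟩ := h.exists_followsWord hk hq
  rw [h.iterate_wordLength hs, h.iterate_wordLength ht]
  simp only
  rw [abs_codeY_sub h.adm, h.steering.length_word]
  refine mul_le_of_le_one_right (pow_nonneg h.adm.lss_pos.le _) ?_
  have h1 := hs.snd_mem
  have h2 := ht.snd_mem
  rw [abs_le]
  constructor <;> linarith [h1.1, h1.2, h2.1, h2.2]

/-- Along the word all differences are controlled by those at the two ends: `x` by the landing
points, `y` and `z` by the start. Time `1` is omitted, as no formula is known outside the cube. -/
lemma dist_stage_le (h : Tower c f g b v ρ E K) {k : ℕ} (hk : K ≤ k) {p q : E3}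
    (hp : p ∈ box c b v ρ k) (hq : q ∈ box c b v ρ k) {σ : ℝ} (h1 : 2 * ρ k ≤ σ)
    (h2 : 2 * ρ (k + 1) ≤ σ) (h3 : 2 * ρ k ^ 2 ≤ σ) (h4 : c.a4 * (2 * ρ k) ≤ σ)
    (h5 : |p.2.1 - q.2.1| ≤ σ) :
    dist p q ≤ σ ∧ ∀ j, j ≤ wordLength k → dist (g^[j + 2] p) (g^[j + 2] q) ≤ σ := by
  have hc := h.adm
  obtain ⟨x, y, z⟩ := p
  obtain ⟨x', y', z'⟩ := q
  obtain ⟨hx1, hx2⟩ := abs_lt.1 hp.1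
  obtain ⟨hx1', hx2'⟩ := abs_lt.1 hq.1
  obtain ⟨hz1, hz2⟩ := abs_lt.1 hp.2.2
  obtain ⟨hz1', hz2'⟩ := abs_lt.1 hq.2.2
  simp only at hx1 hx2 hx1' hx2' hz1 hz2 hz1' hz2' h5
  have hxx : |x - x'| ≤ 2 * ρ k := by rw [abs_le]; constructor <;> linarith
  have hzz : |z - z'| ≤ 2 * ρ k ^ 2 := by rw [abs_le]; constructor <;> linarith
  refine ⟨dist_mk_le (hxx.trans h1) h5 (hzz.trans h3), fun j hj => ?_⟩
  obtain ⟨s, hs, hws⟩ := h.exists_followsWord hk hp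
  obtain ⟨t, ht, hwt⟩ := h.exists_followsWord hk hq
  obtain ⟨hs1, hs2⟩ := abs_lt.1 hs
  obtain ⟨ht1, ht2⟩ := abs_lt.1 ht
  have hst : |s - t| ≤ σ := by rw [abs_le]; constructor <;> linarith
  have hX : ∀ w, |codeX c w s - codeX c w t| ≤ σ := fun w => by
    rw [abs_codeX_sub hc]
    exact (div_le_self (abs_nonneg _) (one_le_pow₀ hc.one_lt_lu.le)).trans hst
  have hY0 : |(c.a3 * (y - 1 / 2) + 1 / 2) - (c.a3 * (y' - 1 / 2) + 1 / 2)| ≤ σ := by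
    rw [add_sub_add_right_eq_sub, ← mul_sub, abs_mul, sub_sub_sub_cancel_right]
    refine (mul_le_of_le_one_left (abs_nonneg _) ?_).trans h5
    linarith [hc.a3_lt, hc.lss_pos]
  have hZ0 : |(c.a4 * (x - 1 / 2) + 1 / 2) - (c.a4 * (x' - 1 / 2) + 1 / 2)| ≤ σ := by
    rw [add_sub_add_right_eq_sub, ← mul_sub, abs_mul, sub_sub_sub_cancel_right,
      abs_of_pos hc.a4_pos]
    exact (mul_le_mul_of_nonneg_left hxx hc.a4_pos.le).trans h4
  rcases Nat.eq_zero_or_pos j with rfl | hj0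
  · rw [zero_add, hws.second, hwt.second]
    refine dist_mk_le ?_ hY0 hZ0
    rw [sub_sub_sub_cancel_right]; exact hX _
  · rw [hws.later_eq hc h.model hj0 (by rwa [h.steering.length_word]),
      hwt.later_eq hc h.model hj0 (by rwa [h.steering.length_word])]
    refine dist_mk_le (hX _) ?_ ?_
    · rw [abs_codeY_sub hc]
      exact (mul_le_of_le_one_left (abs_nonneg _) (pow_le_one₀ hc.lss_pos.le
        (by linarith [hc.lss_lt, hc.lcs0_lt]))).trans hY0
    · rw [abs_codeZ_sub hc]
      exact (mul_le_of_le_one_left (abs_nonneg _) (rateZ_le_one hc _)).trans hZ0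

lemma eventually_dist_le (h : Tower c f g b v ρ E K) {ε : ℝ} (hε : 0 < ε) :
    ∀ᶠ m in atTop, ∀ j < wordLength (K + m) + 2, ∀ p ∈ box c b v ρ K, ∀ q ∈ box c b v ρ K,
      dist (g^[time K m + j] p) (g^[time K m + j] q) ≤ ε := by
  have hc := h.adm
  -- Uniform continuity of `f` on the cube handles the single iterate of each stage that lies
  -- outside it.
  obtain ⟨σ, hσ, huc⟩ := Metric.uniformContinuousOn_iff.1
    (isCompact_cube.uniformContinuousOn_of_continuous h.cont.continuousOn) ε hε
  set θ := min ε (σ / 2) with hθ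
  have hθ0 : 0 < θ := by positivity
  have hKm : Tendsto (fun m => K + m) atTop atTop :=
    tendsto_atTop_mono (fun i => by simp only [id]; omega) tendsto_id
  have hρ : Tendsto (fun m => ρ (K + (m + 1))) atTop (𝓝 0) :=
    h.tendsto.comp (hKm.comp (tendsto_add_atTop_nat 1))
  have hρ' : Tendsto (fun m => ρ (K + (m + 1) + 1)) atTop (𝓝 0) :=
    h.tendsto.comp ((tendsto_add_atTop_nat 1).comp (hKm.comp (tendsto_add_atTop_nat 1)))
  have l1 : Tendsto (fun m => 2 * ρ (K + (m + 1))) atTop (𝓝 0) := by simpa using hρ.const_mul 2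
  have l2 : Tendsto (fun m => 2 * ρ (K + (m + 1) + 1)) atTop (𝓝 0) := by
    simpa using hρ'.const_mul 2
  have l3 : Tendsto (fun m => 2 * ρ (K + (m + 1)) ^ 2) atTop (𝓝 0) := by
    simpa using (hρ.pow 2).const_mul 2
  have l4 : Tendsto (fun m => c.a4 * (2 * ρ (K + (m + 1)))) atTop (𝓝 0) := by
    simpa using l1.const_mul c.a4
  have l5 : Tendsto (fun m => c.lss ^ wordLength (K + m)) atTop (𝓝 0) :=
    (tendsto_pow_atTop_nhds_zero_of_lt_one hc.lss_pos.le
      (by linarith [hc.lss_lt, hc.lcs0_lt])).comp (wordLength_tendsto.comp hKm)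
  have key : ∀ᶠ m in atTop, ∀ j < wordLength (K + (m + 1)) + 2, ∀ p ∈ box c b v ρ K,
      ∀ q ∈ box c b v ρ K,
      dist (g^[time K (m + 1) + j] p) (g^[time K (m + 1) + j] q) ≤ ε := by
    filter_upwards [l1.eventually_le_const hθ0, l2.eventually_le_const hθ0,
      l3.eventually_le_const hθ0, l4.eventually_le_const hθ0, l5.eventually_le_const hθ0]
      with m e1 e2 e3 e4 e5 j hj p hp q hq
    have hp0 := h.iterate_time_mem_box hp m
    have hq0 := h.iterate_time_mem_box hq m
    have hp1 := h.iterate_time_mem_box hp (m + 1)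
    have hq1 := h.iterate_time_mem_box hq (m + 1)
    have hy : |(g^[time K (m + 1)] p).2.1 - (g^[time K (m + 1)] q).2.1| ≤ θ := by
      have := h.abs_sub_snd_le (Nat.le_add_right K m) hp0 hq0
      rw [← Function.iterate_add_apply, ← Function.iterate_add_apply] at this
      rw [time, add_comm]
      exact this.trans e5
    obtain ⟨d0, d1⟩ := h.dist_stage_le (Nat.le_add_right K (m + 1)) hp1 hq1 e1 e2 e3 e4 hy
    rw [add_comm (time K (m + 1)), Function.iterate_add_apply, Function.iterate_add_apply]
    rcases j with _ | _ | j
    · exact d0.trans (min_le_left _ _)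
    · obtain ⟨s, -, hws⟩ := h.exists_followsWord (Nat.le_add_right K (m + 1)) hp1
      obtain ⟨t, -, hwt⟩ := h.exists_followsWord (Nat.le_add_right K (m + 1)) hq1
      rw [zero_add, Function.iterate_one, hws.map_eq, hwt.map_eq]
      refine (huc _ (h.box_subset_gap (by omega) hp1).1 _ (h.box_subset_gap (by omega) hq1).1 ?_).le
      exact (d0.trans (min_le_right _ _)).trans_lt (by linarith)
    · exact (d1 j (by omega)).trans (min_le_left _ _)
  obtain ⟨M, hM⟩ := eventually_atTop.1 key
  refine eventually_atTop.2 ⟨M + 1, fun m hm => ?_⟩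
  obtain ⟨i, rfl⟩ := Nat.exists_eq_add_of_le' (by omega : 1 ≤ m)
  exact hM i (by omega)

theorem isContracting (h : Tower c f g b v ρ E K) : IsContracting g (domain c b v ρ K) := by
  rw [IsContracting, ENNReal.tendsto_nhds_zero]
  intro ε hε
  obtain ⟨ε', hε', hle⟩ : ∃ ε' : ℝ, 0 < ε' ∧ ENNReal.ofReal ε' ≤ ε := by
    rcases eq_or_ne ε ⊤ with rfl | htop
    · exact ⟨1, one_pos, le_top⟩
    · exact ⟨ε.toReal, ENNReal.toReal_pos hε.ne' htop, ENNReal.ofReal_toReal_le⟩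
  obtain ⟨M, hM⟩ := eventually_atTop.1 (h.eventually_dist_le hε')
  refine eventually_atTop.2 ⟨time K M, fun i hi => ?_⟩
  obtain ⟨m, j, rfl, hj⟩ := exists_time_add K i
  have hm : M ≤ m := by
    by_contra hlt
    have h1 := (time_strictMono K).monotone (show m + 1 ≤ M by omega)
    rw [time] at h1
    omega
  refine le_trans (Metric.ediam_le ?_) hle
  rintro _ ⟨p, hp, rfl⟩ _ ⟨q, hq, rfl⟩
  rw [edist_dist]
  exact ENNReal.ofReal_le_ofReal
    (hM m hm j hj p (domain_subset_box _ hp) q (domain_subset_box _ hq))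

end Tower

/-! ### Empirical measures -/

lemma integral_empirical (g : E3 → E3) (x : E3) (n : ℕ) (φ : E3 → ℝ) :
    ∫ q, φ q ∂(empirical g x n) = (∑ i ∈ Finset.range (n + 1), φ (g^[i] x)) / ((n + 1 : ℕ) : ℝ) := by
  rw [empirical, integral_smul_measure, integral_finsetSum_measure]
  · simp only [integral_dirac]
    rw [ENNReal.toReal_inv, smul_eq_mul, mul_comm, ← div_eq_mul_inv]
    congr 1
    rw [show (n : ENNReal) + 1 = ((n + 1 : ℕ) : ENNReal) by push_cast; rfl, ENNReal.toReal_natCast]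
  · intro i _
    exact integrable_dirac (by simp)

lemma weakStarTendsto_empirical_iff (g : E3 → E3) (x : E3) (ν : Measure E3) :
    WeakStarTendsto (empirical g x) ν ↔ ∀ φ : E3 → ℝ, Continuous φ → HasCompactSupport φ →
      Tendsto (fun n : ℕ => (∑ i ∈ Finset.range n, φ (g^[i] x)) / (n : ℝ)) atTop
        (𝓝 (∫ q, φ q ∂ν)) := by
  refine forall_congr' fun φ => forall_congr' fun _ => forall_congr' fun _ => ?_
  simp only [integral_empirical]
  exact tendsto_add_atTop_iff_nat (f := fun n : ℕ =>
    (∑ i ∈ Finset.range n, φ (g^[i] x)) / (n : ℝ)) 1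

lemma sum_range_le_of_good {ψ : ℕ → ℝ} {C ε : ℝ} {N a d : ℕ} (hC : ∀ j, ψ j ≤ C) (hε : 0 ≤ ε)
    (had : a ≤ d) (hdN : d ≤ N) (hgood : ∀ j, a ≤ j → j < d → ψ j ≤ ε) :
    ∑ j ∈ Finset.range N, ψ j ≤ ε * N + C * (a + (N - d : ℕ)) := by
  rw [← Finset.sum_range_add_sum_Ico ψ hdN, ← Finset.sum_range_add_sum_Ico ψ had]
  have h1 : ∑ j ∈ Finset.range a, ψ j ≤ a * C := by
    simpa using Finset.sum_le_card_nsmul (Finset.range a) ψ C fun j _ => hC j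
  have h2 : ∑ j ∈ Finset.Ico a d, ψ j ≤ (d - a : ℕ) * ε := by
    simpa using Finset.sum_le_card_nsmul (Finset.Ico a d) ψ ε fun j hj =>
      hgood j (Finset.mem_Ico.1 hj).1 (Finset.mem_Ico.1 hj).2
  have h3 : ∑ j ∈ Finset.Ico d N, ψ j ≤ (N - d : ℕ) * C := by
    simpa using Finset.sum_le_card_nsmul (Finset.Ico d N) ψ C fun j _ => hC j
  have h4 : ((d - a : ℕ) : ℝ) * ε ≤ N * ε := by
    gcongr; omega
  linarith

lemma wordLength_mono : Monotone wordLength := fun a b h => by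
  unfold wordLength; gcongr

lemma sum_range_time_succ (K m : ℕ) (ψ : ℕ → ℝ) :
    ∑ i ∈ Finset.range (time K (m + 1)), ψ i = ∑ i ∈ Finset.range (time K m), ψ i +
      ∑ j ∈ Finset.range (wordLength (K + m) + 2), ψ (time K m + j) := by
  rw [time, Finset.sum_range_add]

/-- Word lengths grow polynomially, so a stage is at most `16` times as long as the preceding one.
An incomplete stage thus costs only a bounded factor in the averages. -/
lemma time_succ_le (K m : ℕ) (hm : 1 ≤ m) : time K (m + 1) ≤ 17 * time K m := by
  obtain ⟨i, rfl⟩ := Nat.exists_eq_add_of_le' hm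
  have h : wordLength (K + (i + 1)) + 2 ≤ 16 * (wordLength (K + i) + 2) := by
    rw [← add_assoc, wordLength_succ]
    unfold wordLength
    nlinarith [sq_nonneg (K + i)]
  rw [time, time]
  omega

/-- If the sums over the stages are small with respect to their lengths, so are all averages. -/
lemma tendsto_average_zero {K : ℕ} {ψ : ℕ → ℝ} (h0 : ∀ i, 0 ≤ ψ i)
    (hψ : ∀ ε : ℝ, 0 < ε → ∀ᶠ m in atTop,
      ∑ j ∈ Finset.range (wordLength (K + m) + 2), ψ (time K m + j)
        ≤ ε * (wordLength (K + m) + 2 : ℕ)) :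
    Tendsto (fun n : ℕ => (∑ i ∈ Finset.range n, ψ i) / (n : ℝ)) atTop (𝓝 0) := by
  rw [Metric.tendsto_atTop]
  intro ε hε
  -- Completing the last stage costs a factor `17` and the initial sum `C` one more share: `18 / 36
  -- < 1`.
  obtain ⟨M, hM⟩ := eventually_atTop.1 (hψ (ε / 36) (by positivity))
  set C := ∑ i ∈ Finset.range (time K M), ψ i with hC
  have hstage : ∀ m, M ≤ m → ∑ i ∈ Finset.range (time K m), ψ i ≤ C + ε / 36 * time K m := by
    intro m hm
    induction m, hm using Nat.le_induction with
    | base => simp only [hC]; have : 0 ≤ ε / 36 * (time K M : ℝ) := by positivity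
              linarith
    | succ m hm ih =>
      rw [sum_range_time_succ]
      have := hM m hm
      rw [time]
      push_cast at this ⊢
      linarith
  obtain ⟨N0, hN0⟩ := exists_nat_gt (C / (ε / 36))
  refine ⟨max (time K (M + 1)) (N0 + 1), fun N hN => ?_⟩
  have hN1 : time K (M + 1) ≤ N := (le_max_left _ _).trans hN
  have hN2 : N0 + 1 ≤ N := (le_max_right _ _).trans hN
  obtain ⟨m, j, hmj, hj⟩ := exists_time_add K N
  have hm : M + 1 ≤ m := by
    by_contra hlt
    have h1 := (time_strictMono K).monotone (show m + 1 ≤ M + 1 by omega)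
    rw [time] at h1
    omega
  have h1 : ∑ i ∈ Finset.range N, ψ i ≤ C + ε / 36 * time K (m + 1) := by
    refine le_trans ?_ (hstage (m + 1) (by omega))
    refine Finset.sum_le_sum_of_subset_of_nonneg ?_ fun i _ _ => h0 i
    refine Finset.range_subset_range.2 ?_
    rw [time]; omega
  have h2 : (time K (m + 1) : ℝ) ≤ 17 * N := by
    have := (time_succ_le K m (by omega)).trans (Nat.mul_le_mul_left 17 (show time K m ≤ N by omega))
    exact_mod_cast this
  have hNpos : (0 : ℝ) < N := by exact_mod_cast (by omega : 0 < N)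
  have h3 : C ≤ ε / 36 * N := by
    have : (N0 : ℝ) ≤ N := by exact_mod_cast (by omega : N0 ≤ N)
    rw [div_lt_iff₀ (by positivity)] at hN0
    nlinarith
  rw [Real.dist_eq, sub_zero, abs_of_nonneg (div_nonneg (Finset.sum_nonneg fun i _ => h0 i) hNpos.le),
    div_lt_iff₀ hNpos]
  have h4 : ε / 36 * (time K (m + 1) : ℝ) ≤ ε / 36 * (17 * N) := by gcongr
  have : 0 < ε * N := by positivity
  linarith

/-! ### Convergence to the Dirac measure at the saddle -/

lemma block_false (n : ℕ) : block false n = List.replicate (2 * n) false := by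
  induction n with
  | zero => rfl
  | succ n ih => rw [block_succ, ih, mul_add, mul_one, add_comm, List.replicate_add]; rfl

lemma codeY_replicate {c : Params} (k : ℕ) (y : ℝ) :
    codeY c (List.replicate k false) y = c.lss ^ k * y := by
  induction k generalizing y with
  | zero => simp [codeY]
  | succ k ih => simp [List.replicate_succ, codeY, ih, pow_succ, mul_assoc]

lemma codeZ_replicate {c : Params} (k : ℕ) (z : ℝ) :
    codeZ c (List.replicate k false) z = c.lcs0 ^ k * z := by
  induction k generalizing z with
  | zero => simp [codeZ]
  | succ k ih => simp [List.replicate_succ, codeZ, ih, pow_succ, mul_assoc]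

namespace Tower

variable {c : Params} {f g : E3 → E3} {b : ℕ → Bool} {v : ℕ → List Bool} {ρ E : ℕ → ℝ} {K : ℕ}

/-- In the middle of a block of zeros the orbit is close to the fixed point. -/
lemma dist_zero_le (h : Tower c f g b v ρ E K) {k : ℕ} (hk : K ≤ k) (hb : b k = false) {p : E3}
    (hp : p ∈ box c b v ρ k) {M i : ℕ} (hM : M ≤ i) (hi : i + M ≤ 2 * k ^ 3) :
    dist (g^[k + 3 + i] p) 0 ≤ (1 / 2) ^ M := by
  have hc := h.adm
  obtain ⟨s, -, hw⟩ := h.exists_followsWord hk hp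
  set u := List.replicate k false ++ ([true] ++ List.replicate i false) with hu
  set u' := List.replicate (2 * k ^ 3 - i) false ++ v k with hu'
  have hword : word b v k = u ++ u' := by
    have : List.replicate (2 * k ^ 3) false
        = List.replicate i false ++ List.replicate (2 * k ^ 3 - i) false := by
      rw [← List.replicate_add]; congr 1; omega
    rw [word, prefixWord, hb, block_false, this, hu, hu']
    simp only [List.append_assoc, List.cons_append, List.nil_append]
  have hlen : u.length = k + 1 + i := by simp [hu]; omega
  have key := hw.later_eq hc h.model (j := k + 1 + i) (by omega) (by
    rw [hword, List.length_append, hlen]; omega)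
  rw [show k + 3 + i = k + 1 + i + 2 by ring, key, hword, ← hlen, List.drop_left, List.take_left]
  have hpow : ∀ (a : ℝ) (n : ℕ), 0 ≤ a → a ≤ 1 / 2 → M ≤ n → a ^ n ≤ (1 / 2) ^ M := by
    intro a n h0 h1 hn
    exact (pow_le_pow_left₀ h0 h1 n).trans
      (pow_le_pow_of_le_one (by norm_num) (by norm_num) hn)
  have hX := codeX_mem hc (v k) hw.land_mem
  -- The `x`-coordinate is small because at least `M` zeros are still ahead, `y` and `z` because at
  -- least `M` zeros are behind.
  refine dist_mk_le ?_ ?_ ?_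
  · rw [hu', codeX_replicate, sub_zero, abs_of_nonneg (div_nonneg hX.1 (pow_pos hc.lu_pos _).le)]
    calc _ ≤ 1 / c.lu ^ (2 * k ^ 3 - i) := by
          have := pow_pos hc.lu_pos (2 * k ^ 3 - i)
          gcongr
          exact hX.2
      _ = c.lu⁻¹ ^ (2 * k ^ 3 - i) := by rw [inv_pow, one_div]
      _ ≤ _ := hpow _ _ hc.inv_pos.le hc.inv_lt.le (by omega)
  · rw [hu, codeY_append, codeY_append, codeY_replicate, sub_zero]
    have hY := codeY_mem hc [true] (codeY_mem hc (List.replicate k false) hw.snd_mem)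
    rw [abs_of_nonneg (mul_nonneg (pow_nonneg hc.lss_pos.le _) hY.1)]
    exact (mul_le_of_le_one_right (pow_nonneg hc.lss_pos.le _) hY.2).trans
      (hpow _ _ hc.lss_pos.le (by linarith [hc.lss_lt, hc.lcs0_lt]) hM)
  · rw [hu, codeZ_append, codeZ_append, codeZ_replicate, sub_zero]
    have hZ := codeZ_mem hc [true] (codeZ_mem hc (List.replicate k false) hw.trd_mem)
    rw [abs_of_nonneg (mul_nonneg (pow_nonneg hc.lcs0_pos.le _) hZ.1)]
    exact (mul_le_of_le_one_right (pow_nonneg hc.lcs0_pos.le _) hZ.2).trans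
      (hpow _ _ hc.lcs0_pos.le hc.lcs0_lt.le hM)

/-- Stage `k` contains a run of `2 * k ^ 3` zeros, during which the orbit is near the origin except
for `M` steps at each end. The exceptional times number `O(k ^ 2)`, hence have density zero. -/
theorem weakStarTendsto_dirac (h : Tower c f g b v ρ E K) (hb : ∀ k, b k = false) {x : E3}
    (hx : x ∈ box c b v ρ K) : WeakStarTendsto (empirical g x) (Measure.dirac 0) := by
  rw [weakStarTendsto_empirical_iff]
  intro φ hφ hcs
  rw [integral_dirac]
  obtain ⟨B, hB⟩ := hφ.bounded_above_of_compact_support hcs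
  set ψ : ℕ → ℝ := fun i => |φ (g^[i] x) - φ 0| with hψ
  have hψ0 : ∀ i, 0 ≤ ψ i := fun i => abs_nonneg _
  have hψB : ∀ i, ψ i ≤ 2 * B := fun i => by
    have h1 := abs_le.1 (hB (g^[i] x))
    have h2 := abs_le.1 (hB 0)
    simp only [hψ]
    rw [abs_le]
    constructor <;> linarith
  have hB0 : 0 ≤ B := (norm_nonneg _).trans (hB 0)
  have hav : Tendsto (fun n : ℕ => (∑ i ∈ Finset.range n, ψ i) / (n : ℝ)) atTop (𝓝 0) := by
    refine tendsto_average_zero (K := K) hψ0 fun ε hε => ?_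
    obtain ⟨θ, hθ, hcont⟩ := Metric.continuous_iff.1 hφ 0 (ε / 2) (by positivity)
    obtain ⟨M, hM⟩ := exists_pow_lt_of_lt_one hθ (by norm_num : (1 / 2 : ℝ) < 1)
    obtain ⟨L, hL⟩ := exists_nat_gt (2 * B * (5 + 2 * M) / (ε / 2))
    filter_upwards [eventually_ge_atTop (L + M + 1)] with m hm
    set k := K + m with hk
    have hkm : m ≤ k := by omega
    have hk3 : k ≤ k ^ 3 := Nat.le_self_pow (by norm_num) k
    have hkk : k ≤ k ^ 2 := Nat.le_self_pow (by norm_num) k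
    have hbox := h.iterate_time_mem_box hx m
    have hsum := sum_range_le_of_good (ψ := fun j => ψ (time K m + j)) (C := 2 * B) (ε := ε / 2)
      (N := wordLength k + 2) (a := k + 3 + M) (d := k + 3 + (2 * k ^ 3 - M)) (fun j => hψB _)
      (by positivity) (by omega) (by unfold wordLength; omega) (by
        intro j hj1 hj2
        obtain ⟨i, rfl⟩ := Nat.exists_eq_add_of_le (show k + 3 ≤ j by omega)
        have h1 := h.dist_zero_le (Nat.le_add_right K m) (hb _) hbox (M := M) (i := i)
          (by omega) (by rw [← hk]; omega)
        rw [← Function.iterate_add_apply, ← hk, add_comm] at h1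
        have h2 := hcont _ (h1.trans_lt hM)
        rw [Real.dist_eq] at h2
        exact h2.le)
    refine hsum.trans ?_
    have hnat : k + 3 + M + (wordLength k + 2 - (k + 3 + (2 * k ^ 3 - M))) ≤ (5 + 2 * M) * k ^ 2 := by
      have h1 : 1 ≤ k ^ 2 := Nat.one_le_pow _ _ (by omega)
      have h2 : M ≤ M * k ^ 2 := Nat.le_mul_of_pos_right _ h1
      have h3 : (5 + 2 * M) * k ^ 2 = 5 * k ^ 2 + 2 * (M * k ^ 2) := by ring
      rw [h3]
      unfold wordLength; omega
    have hreal : ((k + 3 + M : ℕ) : ℝ) + (wordLength k + 2 - (k + 3 + (2 * k ^ 3 - M)) : ℕ)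
        ≤ (5 + 2 * M) * (k : ℝ) ^ 2 := by exact_mod_cast hnat
    have hLk : (L : ℝ) ≤ k := by exact_mod_cast (by omega : L ≤ k)
    rw [div_lt_iff₀ (by positivity)] at hL
    have hlen : (k : ℝ) ^ 3 ≤ (wordLength k + 2 : ℕ) := by
      have : k ^ 3 ≤ wordLength k + 2 := by unfold wordLength; omega
      exact_mod_cast this
    have h5 : 2 * B * ((k + 3 + M : ℕ) + (wordLength k + 2 - (k + 3 + (2 * k ^ 3 - M)) : ℕ))
        ≤ ε / 2 * (wordLength k + 2 : ℕ) := by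
      calc _ ≤ 2 * B * ((5 + 2 * M) * (k : ℝ) ^ 2) := by gcongr
        _ = 2 * B * (5 + 2 * M) * (k : ℝ) ^ 2 := by ring
        _ ≤ (L * (ε / 2)) * (k : ℝ) ^ 2 := by gcongr
        _ ≤ (k * (ε / 2)) * (k : ℝ) ^ 2 := by gcongr
        _ = ε / 2 * (k : ℝ) ^ 3 := by ring
        _ ≤ _ := by gcongr
    linarith
  rw [tendsto_iff_norm_sub_tendsto_zero]
  refine squeeze_zero' (.of_forall fun n => norm_nonneg _) ?_ hav
  filter_upwards [eventually_gt_atTop 0] with n hn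
  have hn' : (0 : ℝ) < n := by exact_mod_cast hn
  have e : (∑ i ∈ Finset.range n, φ (g^[i] x)) / (n : ℝ) - φ 0
      = (∑ i ∈ Finset.range n, (φ (g^[i] x) - φ 0)) / n := by
    rw [Finset.sum_sub_distrib]; simp; field_simp
  rw [e, Real.norm_eq_abs, abs_div, abs_of_pos hn']
  gcongr
  exact Finset.abs_sum_le_sum_abs _ _

end Tower

/-! ### Historic behaviour -/

/-- The letters alternate over longer and longer eras. -/
def alternating (k : ℕ) : Bool := decide (Odd (Nat.log 16 k))

lemma alternating_eq {e k : ℕ} (h1 : 16 ^ e ≤ k) (h2 : k < 16 ^ (e + 1)) :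
    alternating k = decide (Odd e) := by
  rw [alternating, Nat.log_eq_of_pow_le_of_lt_pow h1 h2]

lemma count_block_false (b : Bool) (n : ℕ) :
    (block b n).count false = if b then n else 2 * n := by
  induction n with
  | zero => simp [block]
  | succ n ih =>
    rw [block_succ, List.count_append, ih]
    cases b <;> simp <;> ring

lemma count_prefixWord_false (b : Bool) (k : ℕ) :
    (prefixWord b k).count false = k + if b then k ^ 3 else 2 * k ^ 3 := by
  rw [prefixWord, List.count_append, List.count_cons_of_ne (by simp), count_block_false]
  simp

lemma time_le_mul (K m : ℕ) : time K m ≤ m * (wordLength (K + m) + 2) := by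
  induction m with
  | zero => simp [time]
  | succ m ih =>
    have h := wordLength_mono (show K + m ≤ K + (m + 1) by omega)
    rw [time]
    rw [add_mul, one_mul]
    exact add_le_add (ih.trans (by gcongr)) (by gcongr)

lemma mul_le_time_add (K i d : ℕ) : d * (wordLength (K + i) + 2) ≤ time K (i + d) := by
  induction d with
  | zero => simp
  | succ d ih =>
    have h := wordLength_mono (show K + i ≤ K + (i + d) by omega)
    rw [← add_assoc, time]
    calc _ = d * (wordLength (K + i) + 2) + (wordLength (K + i) + 2) := by ring
      _ ≤ _ := by gcongr

/-- The time before an era is negligible compared to the time at its end. -/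
lemma sixteen_mul_time_le {K k : ℕ} (hk : K + 1 ≤ k) :
    16 * time K (k - K) ≤ time K (16 * k - K) := by
  have h1 := time_le_mul K (k - K)
  have h2 := mul_le_time_add K (8 * k - K) (8 * k)
  rw [show 8 * k - K + 8 * k = 16 * k - K by omega] at h2
  rw [show K + (k - K) = k by omega] at h1
  rw [show K + (8 * k - K) = 8 * k by omega] at h2
  have h3 : (k - K) * (wordLength k + 2) ≤ k * (7 * k ^ 3) := by
    refine Nat.mul_le_mul (Nat.sub_le _ _) ?_
    have : k ^ 2 ≤ k ^ 3 := Nat.pow_le_pow_right (by omega) (by norm_num)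
    have : k ≤ k ^ 3 := Nat.le_self_pow (by norm_num) k
    have : 1 ≤ k ^ 3 := Nat.one_le_pow _ _ (by omega)
    unfold wordLength; omega
  have h4 : 8 * k * (2 * (8 * k) ^ 3) ≤ 8 * k * (wordLength (8 * k) + 2) := by
    refine Nat.mul_le_mul_left _ ?_
    unfold wordLength; omega
  have h5 : 16 * (k * (7 * k ^ 3)) ≤ 8 * k * (2 * (8 * k) ^ 3) := by
    have : 0 ≤ k ^ 4 := Nat.zero_le _
    nlinarith
  omega

lemma disjoint_V0_V1 {c : Params} (hc : c.Admissible) : Disjoint (V0 c.lu) (V1 c.lu) := by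
  rw [Set.disjoint_left]
  intro p h0 h1
  have := h0.1.2
  have := h1.1.1
  linarith [hc.inv_lt]

lemma isCompact_V0 (l : ℝ) : IsCompact (V0 l) :=
  isCompact_Icc.prod (isCompact_Icc.prod isCompact_Icc)

lemma isClosed_V1 (l : ℝ) : IsClosed (V1 l) :=
  (isCompact_Icc.prod (isCompact_Icc.prod isCompact_Icc)).isClosed

lemma IsModel.sum_visits {c : Params} {f : E3 → E3} (hc : c.Admissible) (hf : IsModel c f)
    {φ : E3 → ℝ} (h0 : EqOn φ 1 (V0 c.lu)) (h1 : EqOn φ 0 (V1 c.lu)) (w : List Bool)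
    {s y z : ℝ} (hs : s ∈ Icc (0 : ℝ) 1) (hy : y ∈ Icc (0 : ℝ) 1) (hz : z ∈ Icc (0 : ℝ) 1) :
    ∑ j ∈ Finset.range w.length, φ (f^[j] (codeX c w s, y, z)) = w.count false := by
  induction w generalizing y z with
  | nil => simp
  | cons a w ih =>
    rw [List.length_cons, Finset.sum_range_succ']
    simp only [Function.iterate_succ_apply, hf.apply_code hc a w hs hy hz, Function.iterate_zero,
      id]
    rw [ih (codeY_mem hc _ hy) (codeZ_mem hc _ hz)]
    cases a
    · rw [h0 (codeX_mem_V0 hc w hs hy hz)]; simp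
    · rw [h1 (codeX_mem_V1 hc w hs hy hz)]; simp

namespace Tower

variable {c : Params} {f g : E3 → E3} {b : ℕ → Bool} {v : ℕ → List Bool} {ρ E : ℕ → ℝ} {K : ℕ}

/-- The orbit of `g` agrees with the unperturbed word orbit from time `3` on. The terms of `g` at
times `0, 1, 2` account for the `3`; the first term of the word orbit, which `g` misses, accounts
for the `-1`. -/
lemma sum_visits_stage (h : Tower c f g b v ρ E K) {φ : E3 → ℝ} (h0 : EqOn φ 1 (V0 c.lu))
    (h1 : EqOn φ 0 (V1 c.lu)) (hφ : ∀ q, φ q ∈ Icc (0 : ℝ) 1) {k : ℕ} (hk : K ≤ k) {p : E3}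
    (hp : p ∈ box c b v ρ k) :
    ((word b v k).count false : ℝ) - 1 ≤ ∑ j ∈ Finset.range (wordLength k + 2), φ (g^[j] p) ∧
      ∑ j ∈ Finset.range (wordLength k + 2), φ (g^[j] p) ≤ (word b v k).count false + 3 := by
  obtain ⟨s, -, hw⟩ := h.exists_followsWord hk hp
  have hcount := h.model.sum_visits h.adm h0 h1 (word b v k) hw.land_mem hw.snd_mem hw.trd_mem
  have hlen := h.steering.length_word k
  obtain ⟨n, hn⟩ : ∃ n, wordLength k = n + 1 := ⟨wordLength k - 1, by unfold wordLength; omega⟩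
  rw [hlen, hn, Finset.sum_range_succ'] at hcount
  rw [hn, Finset.sum_range_succ', Finset.sum_range_succ', Finset.sum_range_succ']
  have e : ∀ j ∈ Finset.range n, φ (g^[j + 1 + 1 + 1] p) = φ (f^[j + 1] (codeX c (word b v k) s,
      c.a3 * (p.2.1 - 1 / 2) + 1 / 2, c.a4 * (p.1 - 1 / 2) + 1 / 2)) := by
    intro j hj
    rw [← hw.later (j + 1) (by omega) (by have := Finset.mem_range.1 hj; omega)]
  rw [Finset.sum_congr rfl e]
  have b0 := hφ (f^[0] (codeX c (word b v k) s,
      c.a3 * (p.2.1 - 1 / 2) + 1 / 2, c.a4 * (p.1 - 1 / 2) + 1 / 2))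
  have b1 := hφ (g^[0 + 1 + 1] p)
  have b2 := hφ (g^[0 + 1] p)
  have b3 := hφ (g^[0] p)
  constructor <;> linarith [b0.1, b0.2, b1.1, b1.2, b2.1, b2.2, b3.1, b3.2]

lemma sum_visits_even (h : Tower c f g b v ρ E K) {φ : E3 → ℝ} (h0 : EqOn φ 1 (V0 c.lu))
    (h1 : EqOn φ 0 (V1 c.lu)) (hφ : ∀ q, φ q ∈ Icc (0 : ℝ) 1) {k : ℕ} (hk : K ≤ k) (hk6 : 6 ≤ k)
    (hb : b k = false) {p : E3} (hp : p ∈ box c b v ρ k) :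
    7 / 8 * ((wordLength k + 2 : ℕ) : ℝ) ≤
      ∑ j ∈ Finset.range (wordLength k + 2), φ (g^[j] p) := by
  refine le_trans ?_ (h.sum_visits_stage h0 h1 hφ hk hp).1
  have h2 : k + 2 * k ^ 3 ≤ (word b v k).count false := by
    rw [word, List.count_append, count_prefixWord_false, hb]; simp
  have h3 : ((k : ℝ) + 2 * k ^ 3) ≤ (word b v k).count false := by exact_mod_cast h2
  have h6 : (6 : ℝ) ≤ k := by exact_mod_cast hk6
  rw [wordLength]
  push_cast
  nlinarith [mul_nonneg (sub_nonneg.2 h6) (sq_nonneg (k : ℝ)), mul_nonneg (sub_nonneg.2 h6)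
    (sub_nonneg.2 h6)]

lemma sum_visits_odd (h : Tower c f g b v ρ E K) {φ : E3 → ℝ} (h0 : EqOn φ 1 (V0 c.lu))
    (h1 : EqOn φ 0 (V1 c.lu)) (hφ : ∀ q, φ q ∈ Icc (0 : ℝ) 1) {k : ℕ} (hk : K ≤ k) (hk6 : 6 ≤ k)
    (hb : b k = true) {p : E3} (hp : p ∈ box c b v ρ k) :
    ∑ j ∈ Finset.range (wordLength k + 2), φ (g^[j] p) ≤
      9 / 16 * ((wordLength k + 2 : ℕ) : ℝ) := by
  refine (h.sum_visits_stage h0 h1 hφ hk hp).2.trans ?_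
  have h2 : (word b v k).count false ≤ k + k ^ 3 + k ^ 2 := by
    rw [word, List.count_append, count_prefixWord_false, hb, ← (h.steering k).1]
    simpa using List.count_le_length
  have h3 : ((word b v k).count false : ℝ) ≤ k + k ^ 3 + k ^ 2 := by exact_mod_cast h2
  have h6 : (6 : ℝ) ≤ k := by exact_mod_cast hk6
  rw [wordLength]
  push_cast
  nlinarith [mul_nonneg (sub_nonneg.2 h6) (sq_nonneg (k : ℝ)), mul_nonneg (sub_nonneg.2 h6)
    (sub_nonneg.2 h6)]

/-- Comparison of sums over the stages of an era. -/
lemma sum_visits_era {ψ : ℕ → ℝ} {a : ℝ} {m d : ℕ} (hψ : ∀ i, m ≤ i → i < m + d →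
      a * ((wordLength (K + i) + 2 : ℕ) : ℝ) ≤
        ∑ j ∈ Finset.range (wordLength (K + i) + 2), ψ (time K i + j)) :
    a * ((time K (m + d) : ℝ) - time K m) ≤
      ∑ i ∈ Finset.range (time K (m + d)), ψ i - ∑ i ∈ Finset.range (time K m), ψ i := by
  induction d with
  | zero => simp
  | succ d ih =>
    have h1 := ih fun i hi hi' => hψ i hi (by omega)
    have h2 := hψ (m + d) (by omega) (by omega)
    rw [← add_assoc m d 1, sum_range_time_succ, time]
    push_cast at h2 ⊢
    linarith

/-- An average of `φ`, equal to one on the first slab and zero on the second, is at least `7 / 8`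
over late even eras and at most `9 / 16` over late odd ones. All time before an era is at most a
sixteenth of the time at its end, so the averages up to that end stay above `3 / 4`, respectively
below `5 / 8`. -/
theorem hasHistoricBehaviour (h : Tower c f g alternating v ρ E K) {x : E3}
    (hx : x ∈ box c alternating v ρ K) : HasHistoricBehaviour g x := by
  rintro ⟨ν, -, hν⟩
  rw [weakStarTendsto_empirical_iff] at hν
  obtain ⟨φ, h0, h1, hcs, hφ⟩ := exists_continuous_one_zero_of_isCompact (isCompact_V0 c.lu)
    (isClosed_V1 c.lu) (disjoint_V0_V1 h.adm)
  have hlim := hν φ φ.continuous hcs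
  set l := ∫ q, φ q ∂ν
  set ψ : ℕ → ℝ := fun i => φ (g^[i] x) with hψ
  have hpos : ∀ n, 0 ≤ ∑ i ∈ Finset.range n, ψ i := fun n => Finset.sum_nonneg fun i _ => (hφ _).1
  have hone : ∀ n : ℕ, ∑ i ∈ Finset.range n, ψ i ≤ n := fun n => by
    simpa using Finset.sum_le_card_nsmul (Finset.range n) ψ 1 fun i _ => (hφ _).2
  have hrw : ∀ m j, ψ (time K m + j) = φ (g^[j] (g^[time K m] x)) := fun m j => by
    simp only [hψ]
    rw [add_comm, Function.iterate_add_apply]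
  have hlarge : ∀ e, K + 6 ≤ e → K + 6 ≤ 16 ^ e := fun e he =>
    he.trans (Nat.lt_pow_self (by norm_num)).le
  have hera : ∀ e i, K + 6 ≤ e → 16 ^ e - K ≤ i → i < 16 ^ e - K + 15 * 16 ^ e →
      6 ≤ K + i ∧ alternating (K + i) = decide (Odd e) := by
    intro e i he h1 h2
    have := hlarge e he
    exact ⟨by omega, alternating_eq (by omega) (by rw [pow_succ]; omega)⟩
  have hend : ∀ e, K + 6 ≤ e → 16 ^ e - K + 15 * 16 ^ e = 16 ^ (e + 1) - K := fun e he => by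
    have := hlarge e he
    rw [pow_succ]; omega
  have hshort : ∀ e, K + 6 ≤ e →
      16 * (time K (16 ^ e - K) : ℝ) ≤ time K (16 ^ (e + 1) - K) := by
    intro e he
    have := sixteen_mul_time_le (K := K) (k := 16 ^ e) (by have := hlarge e he; omega)
    rw [pow_succ, mul_comm (16 ^ e)]
    exact_mod_cast this
  have heven : ∀ e, K + 6 ≤ e → ¬ Odd e → 3 / 4 * (time K (16 ^ (e + 1) - K) : ℝ) ≤
      ∑ i ∈ Finset.range (time K (16 ^ (e + 1) - K)), ψ i := by
    intro e he hodd
    have h2 := sum_visits_era (K := K) (ψ := ψ) (a := 7 / 8) (m := 16 ^ e - K) (d := 15 * 16 ^ e)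
      fun i hi hi' => by
        obtain ⟨h6, hb⟩ := hera e i he hi hi'
        simp only [hrw]
        exact h.sum_visits_even h0 h1 hφ (Nat.le_add_right K i) h6 (by simpa [hodd] using hb)
          (h.iterate_time_mem_box hx i)
    rw [hend e he] at h2
    have h3 := hpos (time K (16 ^ e - K))
    have h4 := hshort e he
    have h5 : (0 : ℝ) ≤ time K (16 ^ (e + 1) - K) := Nat.cast_nonneg _
    linarith
  have hodd : ∀ e, K + 6 ≤ e → Odd e →
      ∑ i ∈ Finset.range (time K (16 ^ (e + 1) - K)), ψ i ≤
        5 / 8 * (time K (16 ^ (e + 1) - K) : ℝ) := by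
    intro e he hodd
    have h2 := sum_visits_era (K := K) (ψ := fun i => -ψ i) (a := -(9 / 16)) (m := 16 ^ e - K)
      (d := 15 * 16 ^ e) fun i hi hi' => by
        obtain ⟨h6, hb⟩ := hera e i he hi hi'
        simp only [hrw, Finset.sum_neg_distrib, neg_mul]
        exact neg_le_neg (h.sum_visits_odd h0 h1 hφ (Nat.le_add_right K i) h6
          (by simpa [hodd] using hb) (h.iterate_time_mem_box hx i))
    rw [hend e he, Finset.sum_neg_distrib, Finset.sum_neg_distrib] at h2
    have h3 := hone (time K (16 ^ e - K))
    have h4 := hshort e he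
    have h5 : (0 : ℝ) ≤ time K (16 ^ (e + 1) - K) := Nat.cast_nonneg _
    linarith
  have htends : ∀ θ : ℕ → ℕ, (∀ i, i ≤ θ i) →
      Tendsto (fun i => time K (16 ^ (θ i + 1) - K)) atTop atTop := by
    intro θ hθ
    refine (time_strictMono K).tendsto_atTop.comp
      (tendsto_atTop_mono (fun i => ?_) (tendsto_sub_atTop_nat K))
    have h1 : θ i + 1 < 16 ^ (θ i + 1) := Nat.lt_pow_self (by norm_num)
    have h2 := hθ i
    omega
  have hposT : ∀ θ : ℕ → ℕ, (∀ i, i ≤ θ i) →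
      ∀ᶠ i in atTop, (0 : ℝ) < time K (16 ^ (θ i + 1) - K) := fun θ hθ => by
    filter_upwards [(htends θ hθ).eventually_gt_atTop 0] with i hi
    exact_mod_cast hi
  have hge : 3 / 4 ≤ l := by
    have hθ : ∀ i : ℕ, i ≤ 2 * i := fun i => by omega
    refine ge_of_tendsto (hlim.comp (htends (fun i => 2 * i) hθ)) ?_
    filter_upwards [hposT _ hθ, eventually_ge_atTop (K + 6)] with i hi hK
    simp only [Function.comp_apply]
    rw [le_div_iff₀ hi]
    exact heven (2 * i) (by omega) (by simp)
  have hle : l ≤ 5 / 8 := by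
    have hθ : ∀ i : ℕ, i ≤ 2 * i + 1 := fun i => by omega
    refine le_of_tendsto (hlim.comp (htends (fun i => 2 * i + 1) hθ)) ?_
    filter_upwards [hposT _ hθ, eventually_ge_atTop (K + 6)] with i hi hK
    simp only [Function.comp_apply]
    rw [div_le_iff₀ hi]
    exact hodd (2 * i + 1) (by omega) ⟨i, rfl⟩
  linarith

end Tower

/-! ### The saddle fixed point -/

lemma charpoly_smul_id (a : ℝ) :
    (a • (LinearMap.id : ℝ →ₗ[ℝ] ℝ)).charpoly = Polynomial.X - Polynomial.C a := by
  rw [← LinearMap.charpoly_toMatrix _ (Module.Basis.singleton (Fin 1) ℝ), Matrix.charpoly,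
    Matrix.det_fin_one, Matrix.charmatrix_apply_eq, LinearMap.toMatrix_apply]
  simp

/-- The derivative of the model at the origin. -/
noncomputable def linearPart (c : Params) : E3 →L[ℝ] E3 :=
  (c.lu • ContinuousLinearMap.id ℝ ℝ).prodMap
    ((c.lss • ContinuousLinearMap.id ℝ ℝ).prodMap (c.lcs0 • ContinuousLinearMap.id ℝ ℝ))

lemma linearPart_apply (c : Params) (x y z : ℝ) :
    linearPart c (x, y, z) = (c.lu * x, c.lss * y, c.lcs0 * z) := rfl

lemma charpoly_linearPart (c : Params) : (linearPart c : E3 →ₗ[ℝ] E3).charpoly =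
    (Polynomial.X - Polynomial.C c.lu) *
      ((Polynomial.X - Polynomial.C c.lss) * (Polynomial.X - Polynomial.C c.lcs0)) := by
  have e : (linearPart c : E3 →ₗ[ℝ] E3) = (c.lu • (LinearMap.id : ℝ →ₗ[ℝ] ℝ)).prodMap
      ((c.lss • (LinearMap.id : ℝ →ₗ[ℝ] ℝ)).prodMap (c.lcs0 • (LinearMap.id : ℝ →ₗ[ℝ] ℝ))) := rfl
  rw [e, LinearMap.charpoly_prodMap, LinearMap.charpoly_prodMap, charpoly_smul_id,
    charpoly_smul_id, charpoly_smul_id]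

lemma IsPerturbation.apply_corner {c : Params} (hc : c.Admissible) {f g : E3 → E3} {E : ℕ → ℝ}
    (hf : IsModel c f) (hg : IsPerturbation c f g E) {p : E3}
    (hp : p ∈ Icc 0 c.lu⁻¹ ×ˢ (Icc 0 c.lss ×ˢ Icc (0 : ℝ) 1)) : g p = linearPart c p := by
  obtain ⟨x, y, z⟩ := p
  have hy : y ∈ Icc 0 c.lss := hp.2.1
  rw [hg.of_edge x y z fun h => h.1.not_ge hy.2, linearPart_apply]
  exact hf.on_V0 _ _ _ ⟨hp.1, ⟨hy.1, hy.2.trans (by linarith [hc.lss_lt, hc.lcs0_lt])⟩, hp.2.2⟩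

lemma IsPerturbation.isSaddlePeriodicPt_zero {c : Params} (hc : c.Admissible) {f g : E3 → E3}
    {E : ℕ → ℝ} (hf : IsModel c f) (hg : IsPerturbation c f g E) (hd : DifferentiableAt ℝ g 0) :
    g 0 = 0 ∧ IsSaddlePeriodicPt g 0 := by
  set U : Set E3 := Icc 0 c.lu⁻¹ ×ˢ (Icc 0 c.lss ×ˢ Icc (0 : ℝ) 1) with hU
  have h0U : (0 : E3) ∈ U :=
    ⟨left_mem_Icc.2 hc.inv_pos.le, left_mem_Icc.2 hc.lss_pos.le, left_mem_Icc.2 zero_le_one⟩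
  have hgU : ∀ p ∈ U, g p = linearPart c p := fun p hp => hg.apply_corner hc hf hp
  have hfix : g 0 = 0 := by rw [hgU 0 h0U, map_zero]
  -- The linear formula is known only on a corner with vertex `0`, which is not a neighbourhood.
  -- Together with differentiability of `g` at `0`, it still determines the derivative.
  have huniq : UniqueDiffWithinAt ℝ U 0 :=
    (uniqueDiffOn_Icc hc.inv_pos).prod
      ((uniqueDiffOn_Icc hc.lss_pos).prod (uniqueDiffOn_Icc one_pos)) 0 h0U
  have hderiv : fderiv ℝ g 0 = linearPart c :=
    huniq.eq hd.hasFDerivAt.hasFDerivWithinAt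
      ((linearPart c).hasFDerivAt.hasFDerivWithinAt.congr hgU (hgU 0 h0U))
  have hper : Function.minimalPeriod g 0 = 1 :=
    Function.minimalPeriod_eq_one_iff_isFixedPt.2 hfix
  refine ⟨hfix, ⟨1, one_pos, hfix⟩, ?_⟩
  have hl0 := hc.lcs0_pos
  have hls := hc.lss_pos
  have hlu := hc.lu_pos
  simp only [hper, Function.iterate_one, hderiv, charpoly_linearPart]
  have hn : ∀ a : ℝ, 0 < a → ‖(a : ℂ)‖ = a := fun a ha => by
    rw [Complex.norm_real, Real.norm_of_nonneg ha.le]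
  refine ⟨fun μ hμ => ?_, ⟨(c.lss : ℂ), ?_, ?_⟩, ⟨(c.lu : ℂ), ?_, ?_⟩⟩
  · simp only [map_mul, map_sub, Polynomial.aeval_X, Polynomial.aeval_C, mul_eq_zero,
      sub_eq_zero, Complex.coe_algebraMap] at hμ
    rcases hμ with rfl | rfl | rfl
    · rw [hn _ hlu]; linarith [hc.lt_lu]
    · rw [hn _ hls]; linarith [hc.lss_lt, hc.lcs0_lt]
    · rw [hn _ hl0]; linarith [hc.lcs0_lt]
  · simp
  · rw [hn _ hls]; linarith [hc.lss_lt, hc.lcs0_lt]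
  · simp
  · rw [hn _ hlu]; linarith [hc.lt_lu]

lemma support_dirac_zero : (Measure.dirac (0 : E3)).support = {0} := by
  ext x
  rw [Measure.mem_support_iff_forall, mem_singleton_iff]
  constructor
  · intro h
    by_contra hx
    have := h {0}ᶜ (isOpen_compl_singleton.mem_nhds hx)
    simp at this
  · rintro rfl U hU
    rw [Measure.dirac_apply_of_mem (mem_of_mem_nhds hU)]
    exact one_pos

lemma forwardOrbit_of_fixed {g : E3 → E3} {p : E3} (h : g p = p) : forwardOrbit g p = {p} := by
  have : ∀ i : ℕ, g^[i] p = p := fun i => Function.iterate_fixed h i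
  simp [forwardOrbit, this]

/-! ### The two perturbations -/

lemma diff_injective {r : ℕ} (f : Diff r) : Function.Injective f := f.injective

theorem exists_towers {c : Params} (hc : c.Admissible) {r : ℕ} (hr : 1 ≤ r) {f : Diff r}
    (hf : IsModel c f) {N : Set (Diff r)} (hN : IsCrNeighbourhood f N) :
    ∃ g₁ ∈ N, ∃ g₂ ∈ N, g₁ ≠ g₂ ∧ ∃ ρ K, (∃ v E, Tower c f g₁ alternating v ρ E K) ∧
      ∃ v E, Tower c f g₂ (fun _ => false) v ρ E K := by
  have hlu := hc.lu_pos
  obtain ⟨η, hη, hpert⟩ := exists_isPerturbation hc hr hf hN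
  obtain ⟨ρ, hρ, hρ0, hstage⟩ := exists_goodStage hc
  obtain ⟨v₁, hv₁⟩ := exists_isSteering hc alternating
  obtain ⟨v₂, hv₂⟩ := exists_isSteering hc fun _ => false
  obtain ⟨K₀, hK₀'⟩ := eventually_atTop.1 ((hstage _ _ hv₁).and ((hstage _ _ hv₂).and
    ((hv₁.offset_small hc r hη).and (hv₂.offset_small hc r hη))))
  obtain ⟨K, hK, hKK⟩ : ∃ K, 3 ≤ K ∧ K₀ ≤ K := ⟨K₀ + 3, by omega, by omega⟩
  have hK₀ := fun k (hk : K ≤ k) => hK₀' k (hKK.trans hk)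
  -- To force `g₁ ≠ g₂`, the second map gets the largest allowed translation at index `K - 1`, where
  -- the first has none. No tower uses that index, and `K ≥ 3` keeps it away from `0` and `1`.
  obtain ⟨η', hη'0, hη'⟩ : ∃ η' : ℝ, 0 < η' ∧ η' * (c.lu ^ (K - 1)) ^ r * 2 ^ (K - 1) = η :=
    ⟨η / ((c.lu ^ (K - 1)) ^ r * 2 ^ (K - 1)), by positivity, by field_simp⟩
  obtain ⟨E₁, hE₁, hE₁'⟩ : ∃ E : ℕ → ℝ, (∀ k, K ≤ k → E k = offset c alternating v₁ k) ∧
      ∀ k, ¬ K ≤ k → E k = 0 :=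
    ⟨fun k => if K ≤ k then offset c alternating v₁ k else 0, fun k hk => if_pos hk,
      fun k hk => if_neg hk⟩
  obtain ⟨E₂, hE₂, hE₂', hE₂0⟩ : ∃ E : ℕ → ℝ,
      (∀ k, K ≤ k → E k = offset c (fun _ => false) v₂ k) ∧ E (K - 1) = η' ∧
      ∀ k, ¬ K ≤ k → k ≠ K - 1 → E k = 0 :=
    ⟨fun k => if K ≤ k then offset c (fun _ => false) v₂ k else if k = K - 1 then η' else 0,
      fun k hk => if_pos hk, (if_neg (by omega)).trans (if_pos rfl),
      fun k hk hk' => (if_neg hk).trans (if_neg hk')⟩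
  obtain ⟨g₁, hg₁N, hg₁⟩ := hpert E₁ (hE₁' _ (by omega)) (hE₁' _ (by omega)) fun k => by
    by_cases hk : K ≤ k
    · rw [hE₁ k hk]; exact (hK₀ k hk).2.2.1
    · rw [hE₁' k hk]; simpa using hη.le
  obtain ⟨g₂, hg₂N, hg₂⟩ := hpert E₂ (hE₂0 _ (by omega) (by omega))
    (hE₂0 _ (by omega) (by omega)) fun k => by
    by_cases hk : K ≤ k
    · rw [hE₂ k hk]; exact (hK₀ k hk).2.2.2
    · by_cases hk' : k = K - 1
      · rw [hk', hE₂', abs_of_pos hη'0, hη']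
      · rw [hE₂0 k hk hk']; simpa using hη.le
  refine ⟨g₁, hg₁N, g₂, hg₂N, fun heq => ?_, ρ, K,
    ⟨v₁, E₁, hc, hf, f.continuous, diff_injective g₁, hg₁, hv₁, hρ, hρ0,
      fun k hk => (hK₀ k hk).1, hE₁⟩,
    ⟨v₂, E₂, hc, hf, f.continuous, diff_injective g₂, hg₂, hv₂, hρ, hρ0,
      fun k hk => (hK₀ k hk).2.1, hE₂⟩⟩
  have hx : c.lu ^ (K - 1) * (c.lu ^ (K - 1))⁻¹ ∈
      Icc (1 - c.lu⁻¹ - c.margin) (1 + c.margin) := by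
    rw [mul_inv_cancel₀ (pow_pos hlu _).ne']
    have := hc.margin_pos
    have := hc.inv_pos
    constructor <;> linarith
  have ha := abs_nonneg c.a3
  have hy : (1 / 2 : ℝ) ∈ Icc (1 / 2 - |c.a3| / 2) (1 / 2 + |c.a3| / 2) := by
    constructor <;> linarith
  have hz : (1 / 2 : ℝ) ∈ Icc (1 / 4 : ℝ) (3 / 4) := by constructor <;> norm_num
  have e₁ := hg₁.shift (K - 1) _ _ _ hx hy hz
  have e₂ := hg₂.shift (K - 1) _ _ _ hx hy hz
  rw [heq, e₂] at e₁
  have e₃ := congrArg Prod.fst (diff_injective f e₁)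
  simp only at e₃
  rw [hE₂', hE₁' _ (by omega)] at e₃
  linarith

end WildBlender

theorem mainTheorem2 (c : WildBlender.Params) (hc : c.Admissible) (r : ℕ) (hr : 1 ≤ r)
    (f : WildBlender.Diff r) (hf : WildBlender.IsModel c f)
    (N : Set (WildBlender.Diff r)) (hN : WildBlender.IsCrNeighbourhood f N) :
    ∃ g₁ ∈ N, ∃ g₂ ∈ N, g₁ ≠ g₂ ∧
      (∃ D : Set WildBlender.E3,
        WildBlender.IsHistoricWanderingDomain g₁ D ∧ WildBlender.IsContracting g₁ D) ∧
      (∃ D : Set WildBlender.E3,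
        WildBlender.IsWanderingDomain g₂ D ∧ WildBlender.IsContracting g₂ D ∧
        ∃ ν : MeasureTheory.Measure WildBlender.E3,
          WildBlender.IsNontrivialDiracPhysical g₂ D ν) := by
  obtain ⟨g₁, hg₁N, g₂, hg₂N, hne, ρ, K, ⟨v₁, E₁, T₁⟩, v₂, E₂, T₂⟩ :=
    WildBlender.exists_towers hc hr hf hN
  have hd : DifferentiableAt ℝ g₂ 0 :=
    (WildBlender.diff_contDiff g₂).differentiable (by exact_mod_cast (by omega : r ≠ 0)) 0
  obtain ⟨hfix, hsaddle⟩ := T₂.pert.isSaddlePeriodicPt_zero hc hf hd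
  refine ⟨g₁, hg₁N, g₂, hg₂N, hne, ⟨WildBlender.domain c WildBlender.alternating v₁ ρ K,
    ⟨T₁.isWanderingDomain, fun x hx => ?_⟩, T₁.isContracting⟩,
    ⟨WildBlender.domain c (fun _ => false) v₂ ρ K, T₂.isWanderingDomain, T₂.isContracting,
      MeasureTheory.Measure.dirac 0, inferInstance, fun x hx => ?_, 0, hsaddle, ?_⟩⟩
  · exact T₁.hasHistoricBehaviour (WildBlender.Tower.domain_subset_box _ hx)
  · exact T₂.weakStarTendsto_dirac (fun _ => rfl) (WildBlender.Tower.domain_subset_box _ hx)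
  · rw [WildBlender.support_dirac_zero, WildBlender.forwardOrbit_of_fixed hfix]
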